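/- Let $A$ be a simple Euclidean real Jordan algebra of rank $3$, with unit $e$ and dimension $n=3+3d$, and let $c_1,c_2,c_3$ be a complete system of mutually orthogonal primitive idempotents ($c_1+c_2+c_3=e$). Let $A_0=\{x\in A: c_3x=0\}$ be the corresponding Peirce subalgebra, a Jordan algebra of rank $2$ and dimension $n_0=2+d$ with unit $c_1+c_2$. For $J=A$ (with $r=3$) or $J=A_0$ (with $r=2$), write an element as $x=\sum_{i=1}^r\lambda_i f_i$ with $f_1,\dots,f_r$ a complete system of orthogonal primitive idempotents of $J$ and $\lambda_i\in\mathbb R$, and put $\operatorname{tr}x=\sum_i\lambda_i$, $\det x=\prod_i\lambda_i$; let $\Omega_r\subset J$ be the set of $x$ with all $\lambda_i>0$. Let $(x,y)=\operatorname{tr}(xy)$ and let $dy$ be the Lebesgue measure of the Euclidean space $(J,(\cdot,\cdot))$. For $\nu\in\mathbb C$ and $x\in J$ define $$K^{[r]}_\nu(x)=\int_{\Omega_r}e^{-\operatorname{tr}(y^{-1})-(x,y)}(\det y)^{\nu-\frac{\dim J}{r}}\,dy,$$ whenever the integral converges absolutely. Let $\nu\in\mathbb C$ and let $x=x_1c_1+x_2c_2$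 with $x_1,x_2\ge 0$, a point of the boundary of the cone $\Omega_3$. Then the integral $K^{[3]}_\nu(x)$ converges absolutely if and only if $\operatorname{Re}\nu<0$ and the integral $K^{[2]}_{\nu+d/2}(x_1c_1+x_2c_2)$ converges absolutely; in particular this is the case when $\operatorname{Re}\nu<0$ and $x_1,x_2>0$. Whenever $K^{[3]}_\nu(x)$ converges, $$K^{[3]}_\nu(x_1c_1+x_2c_2)=(2\pi)^d\,\Gamma(-\nu)\,K^{[2]}_{\nu+d/2}(x_1c_1+x_2c_2),$$ where the left side is computed in $A$ and the right side in $A_0$. -/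

import Mathlib

/-!
Real Jordan algebras are commutative, not necessarily associative, unital rings `J` with a
compatible real vector space structure satisfying Mathlib's `IsCommJordan`.
The trace, determinant, cone and K-Bessel function below are those of a Euclidean Jordan algebra
of rank `r`; the rank is an explicit argument.
-/

namespace JordanBessel

section General

variable {J : Type*} [NonAssocCommRing J] [Module ℝ J]

/-- A real Jordan algebra is Euclidean if it carries a positive definite symmetric bilinear form
that is associative, i.e. `(xy, z) = (y, xz)`. -/
def IsEuclidean (J : Type*) [NonAssocCommRing J] [Module ℝ J] : Prop :=
  ∃ β : LinearMap.BilinForm ℝ J, (∀ x y, β x y = β y x) ∧ (∀ x, x ≠ 0 → 0 < β x x) ∧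
    ∀ x y z, β (x * y) z = β y (x * z)

/-- Powers of an element: `x ^ 0 = e`, `x ^ (k + 1) = x * x ^ k`. -/
def jpow (x : J) : ℕ → J
  | 0 => 1
  | k + 1 => x * jpow x k

/-- The subspace `ℝ[x]` spanned by the powers of `x`. Its dimension is the degree of the minimal
polynomial of `x`. -/
def polySpan (x : J) : Submodule ℝ J := Submodule.span ℝ (Set.range (jpow x))

/-- The rank of a (finite dimensional) Jordan algebra: the largest degree of the minimal polynomial
of an element. -/
noncomputable def jrank (J : Type*) [NonAssocCommRing J] [Module ℝ J] : ℕ :=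
  ⨆ x : J, Module.finrank ℝ (polySpan x)

/-- A primitive idempotent: a nonzero idempotent which is not the sum of two nonzero (necessarily
orthogonal) idempotents. -/
structure IsPrimitiveIdempotent (c : J) : Prop where
  ne_zero : c ≠ 0
  idem : c * c = c
  primitive : ∀ a b : J, a * a = a → b * b = b → a * b = 0 → a + b = c → a = 0 ∨ b = 0

/-- A complete system of mutually orthogonal primitive idempotents. -/
structure IsJordanFrame {r : ℕ} (c : Fin r → J) : Prop where
  primitive : ∀ i, IsPrimitiveIdempotent (c i)
  orthogonal : ∀ i j, i ≠ j → c i * c j = 0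
  complete : ∑ i, c i = 1

/-- `x = ∑ i, lam i • c i` for some complete system `c` of `r` orthogonal primitive idempotents. -/
def IsSpectrum (r : ℕ) (x : J) (lam : Fin r → ℝ) : Prop :=
  ∃ c : Fin r → J, IsJordanFrame c ∧ x = ∑ i, lam i • c i

open Classical in
/-- The eigenvalues of `x`, with multiplicity, in some order. -/
noncomputable def eigenvalues (r : ℕ) (x : J) : Fin r → ℝ :=
  if h : ∃ lam, IsSpectrum r x lam then h.choose else 0

/-- The trace of a rank `r` Euclidean Jordan algebra: the sum of the eigenvalues. -/
noncomputable def jtrace (r : ℕ) (x : J) : ℝ := ∑ i, eigenvalues r x i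

/-- The determinant of a rank `r` Euclidean Jordan algebra: the product of the eigenvalues. -/
noncomputable def jdet (r : ℕ) (x : J) : ℝ := ∏ i, eigenvalues r x i

variable (J) in
/-- The cone of positivity `Ω_r`: all eigenvalues are positive. -/
def cone (r : ℕ) : Set J := {x | ∀ i, 0 < eigenvalues r x i}

open Classical in
/-- The inverse of `x`: the element `y` of `ℝ[x]` with `x * y = e` (`0` if `x` is not
invertible). -/
noncomputable def jinv (x : J) : J :=
  if h : ∃ y ∈ polySpan x, x * y = 1 then h.choose else 0

/-- A basis which is orthonormal for the inner product `(x, y) = tr (x * y)`. -/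
def IsTraceOrthonormal (r : ℕ) (b : Module.Basis (Fin (Module.finrank ℝ J)) ℝ J) : Prop :=
  ∀ i j, jtrace r (b i * b j) = if i = j then 1 else 0

open Classical in
variable (J) in
/-- Cartesian coordinates on `J` for the inner product `tr (x * y)`: the linear isomorphism
`ℝⁿ → J` attached to an orthonormal basis. Lebesgue measure `dy` on the Euclidean space `J` is the
image of Lebesgue measure on `ℝⁿ`, and does not depend on the basis. -/
noncomputable def chart (r : ℕ) (u : Fin (Module.finrank ℝ J) → ℝ) : J :=
  if h : ∃ b : Module.Basis (Fin (Module.finrank ℝ J)) ℝ J, IsTraceOrthonormal r b then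
    ∑ i, u i • h.choose i
  else 0

/-- The integrand `exp (- tr y⁻¹ - (x, y)) (det y) ^ (ν - n / r)`, where `n = dim J`. -/
noncomputable def besselIntegrand (r : ℕ) (ν : ℂ) (x y : J) : ℂ :=
  Complex.exp (-(jtrace r (jinv y) : ℂ) - (jtrace r (x * y) : ℂ)) *
    (jdet r y : ℂ) ^ (ν - (Module.finrank ℝ J : ℂ) / (r : ℂ))

/-- The integral defining `K_ν^[r] (x)` converges (absolutely). -/
def BesselConverges (r : ℕ) (ν : ℂ) (x : J) : Prop :=
  MeasureTheory.IntegrableOn (fun u => besselIntegrand r ν x (chart J r u))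
    {u | chart J r u ∈ cone J r}

/-- The K-Bessel function
`K_ν^[r] (x) = ∫_{Ω_r} exp (- tr y⁻¹ - (x, y)) (det y) ^ (ν - n / r) dy`. -/
noncomputable def besselK (r : ℕ) (ν : ℂ) (x : J) : ℂ :=
  ∫ u in {u | chart J r u ∈ cone J r}, besselIntegrand r ν x (chart J r u)

end General

section Peirce

variable {A : Type*} [NonAssocCommRing A] [Module ℝ A]

theorem mul_mul_eq_zero_of_peirce [IsCommJordan A] {c a b : A} (hc : c * c = c)
    (ha : c * a = 0) (hb : c * b = 0) : c * (a * b) = 0 := by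
  have h := two_nsmul_lie_lmul_lmul_add_add_eq_zero a c c
  have hx : ∀ x : A, (2 : ℕ) • x = 0 → x = 0 := by
    intro x hx
    have h2 : (2 : ℝ) • x = 0 := by rw [two_smul, ← two_nsmul]; exact hx
    have h3 := congrArg (fun z => (2⁻¹ : ℝ) • z) h2
    simpa [smul_smul] using h3
  have h' := DFunLike.congr_fun h b
  have h'' := hx _ h'
  have ha' : a * c = 0 := by rw [mul_comm]; exact ha
  simp only [hc, ha, ha', Ring.lie_def, map_zero, mul_zero, zero_mul, sub_zero, add_zero] at h''
  have h3 : a * (c * b) - c * (a * b) = 0 := h''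
  rw [hb, mul_zero, zero_sub, neg_eq_zero] at h3
  exact h3

variable [SMulCommClass ℝ A A] [IsCommJordan A]

/-- The Peirce subalgebra `A₀ = {x | c x = 0}` of an idempotent `c`. -/
def peirceZero (c : A) (hc : c * c = c) : NonUnitalSubalgebra ℝ A where
  carrier := {x | c * x = 0}
  zero_mem' := mul_zero c
  add_mem' := by
    intro a b (ha : c * a = 0) (hb : c * b = 0)
    change c * (a + b) = 0
    rw [mul_add, ha, hb, add_zero]
  mul_mem' := fun ha hb => mul_mul_eq_zero_of_peirce hc ha hb
  smul_mem' := by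
    intro t a (ha : c * a = 0)
    change c * (t • a) = 0
    rw [mul_smul_comm, ha, smul_zero]

/-- `A₀` is a unital algebra, with unit `e₀ = e - c`. -/
instance peirceZeroRing (c : A) (hc : c * c = c) : NonAssocCommRing (peirceZero c hc) where
  __ := (inferInstance : NonUnitalNonAssocRing (peirceZero c hc))
  one := ⟨1 - c, by change c * (1 - c) = 0; rw [mul_sub, mul_one, hc, sub_self]⟩
  mul_comm a b := Subtype.ext (mul_comm (a : A) b)
  one_mul a := Subtype.ext (by
    have ha : c * (a : A) = 0 := a.2
    change (1 - c) * (a : A) = a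
    rw [sub_mul, one_mul, ha, sub_zero])
  mul_one a := Subtype.ext (by
    have ha : c * (a : A) = 0 := a.2
    change (a : A) * (1 - c) = a
    rw [mul_comm, sub_mul, one_mul, ha, sub_zero])

instance peirceZeroIsCommJordan (c : A) (hc : c * c = c) : IsCommJordan (peirceZero c hc) where
  lmul_comm_rmul_rmul a b :=
    Subtype.ext (IsCommJordan.lmul_comm_rmul_rmul (a : A) (b : A))

/-- For a complete system `c₁, c₂, c₃` of orthogonal primitive idempotents (indexed by
`0, 1, 2`), the Peirce subalgebra `A₀` relative to `c₃`, with unit `e₀ = c₁ + c₂`. -/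
abbrev frameZero (c : Fin 3 → A) (hc : IsJordanFrame c) : NonUnitalSubalgebra ℝ A :=
  peirceZero (c 2) (hc.primitive 2).idem

/-- The element `x₁ c₁ + x₂ c₂` of `A₀`. -/
def facePoint (c : Fin 3 → A) (hc : IsJordanFrame c) (x₁ x₂ : ℝ) : frameZero c hc :=
  ⟨x₁ • c 0 + x₂ • c 1, by
    change c 2 * (x₁ • c 0 + x₂ • c 1) = 0
    rw [mul_add, mul_smul_comm, mul_smul_comm, hc.orthogonal 2 0 (by decide),
      hc.orthogonal 2 1 (by decide), smul_zero, smul_zero, add_zero]⟩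

end Peirce

end JordanBessel

/-!
The cone `Ω₃` is fibred over `Ω₂ ⊂ A₀` by Peirce coordinates relative to `c = c₃`, in which the
integrand of `K^[3]` at a point of `A₀` splits off a Gaussian integral and a Gamma integral.

Let `A = A₀ ⊕ A_½ ⊕ ℝ c` be the Peirce decomposition. For `y ∈ A₀` the operator `Φ(y) = 2 L(y)`
acts on `A_½`, and `Φ` is a unital homomorphism of Jordan algebras from `A₀` to symmetric
operators (`mul_mul_of_peirceHalf`). By the Cayley-Hamilton identity for `y` in rank two, the
point `z = y + Φ(y) w + (s + ½ (w, Φ(y) w)) c` (`peircePoint`) satisfies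

* `det z = s det y` (`jdet_peircePoint`),
* `tr z⁻¹ = tr y⁻¹ + 1 / s + |w|² / (2 s)` (`jtrace_jinv_peircePoint`),
* `z ∈ Ω₃` if and only if `y ∈ Ω₂` and `s > 0` (`peircePoint_mem_cone`),
* `(x, z) = (x, y)` for `x ∈ A₀` (`form_peircePoint`).

The Peirce decomposition is orthogonal, so the Jacobian of `(y, w, s) ↦ z` is
`|det Φ(y)| = (det y) ^ d` (`abs_det_peirceRep`). The integral over `w ∈ A_½`, of dimension `2 d`, is `(2 π s) ^ d`,
and that over `s` is `∫ s ^ (ν - 1) exp (-1 / s) ds = Γ(-ν)`, convergent if and only if `Re ν < 0`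
(`integral_gaussGammaKernel`, `integrable_gaussGammaKernel_iff`). What remains is the integrand of
`K^[2]` with parameter `ν + d / 2`. Fubini's theorem is used in both directions: the integrals
over the fibres are nonzero multiples of one fixed integral, so absolute convergence of the total
integral is equivalent to that of both factors (`integrable_prod_iff_of_slices`,
`bessel_reduction`). If `x₁, x₂ > 0` and `Re ν < 0`, then the power of `det y` in `K^[2]` is
nonpositive, hence controlled by `exp (-tr y⁻¹)`, and `exp (-(x, y))` decays exponentially
(`integrable_besselExt_two`).

All this takes place for an inner product in which primitive idempotents have trace one. Trace,
determinant and rank are defined through eigenvalues and minimal polynomials, so it has to be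
derived that every element is a combination of a complete system of primitive idempotents
(`exists_jordanFrame`), that all complete systems have three members (`card_frame_eq_three`), and
that a multiple of the given Euclidean form is the trace form (`exists_isTraceForm_three`). The
last point uses simplicity: for two members `a, b` of a complete system there is
`u ∈ A_½(a) ∩ A_½(b)` whose square is a positive multiple of `a + b` (`IsTriple.exists_offDiagonal`), so that
associative forms take the same value on `a` and `b`. Applied to the form `tr L(x y)`, the same
argument gives `dim A_½ = 2 d` (`IsTriple.finrank_peirceHalf`). Such a `u` for a complete system
of `A₀` that diagonalises `y` exchanges the two eigenspaces of `Φ(y)`, which gives the determinant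
of `Φ(y)`.
-/

namespace JordanBessel

/-! ### The linearised Jordan identity -/

section JordanIdentities

variable {J : Type*} [NonAssocCommRing J] [Module ℝ J]

theorem eq_of_two_smul_eq {x y : J} (h : (2 : ℝ) • x = (2 : ℝ) • y) : x = y :=
  smul_right_injective J (two_ne_zero : (2 : ℝ) ≠ 0) h

/-- The full linearisation of the Jordan identity, written with multiplication operators applied
to `z`. -/
theorem jordan_linearized [IsCommJordan J] (a b c z : J) :
    a * ((b * c) * z) + b * ((c * a) * z) + c * ((a * b) * z) =
      (b * c) * (a * z) + (c * a) * (b * z) + (a * b) * (c * z) := by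
  have h := DFunLike.congr_fun (two_nsmul_lie_lmul_lmul_add_add_eq_zero a b c) z
  have h2 : (2 : ℕ) • (a * ((b * c) * z) - (b * c) * (a * z) +
      (b * ((c * a) * z) - (c * a) * (b * z)) +
      (c * ((a * b) * z) - (a * b) * (c * z))) = 0 := h
  rw [← Nat.cast_smul_eq_nsmul ℝ, smul_eq_zero] at h2
  have h3 := h2.resolve_left (by norm_num)
  rw [← sub_eq_zero, ← h3]
  abel

/-- The Jordan identity, linearised and read as a formula for multiplication by `(x y) w`. -/
theorem mul_mul_mul_eq [IsCommJordan J] (x y w z : J) :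
    ((x * y) * w) * z = (y * w) * (x * z) + (x * y) * (w * z) + (x * w) * (y * z)
      - y * (w * (x * z)) - x * (w * (y * z)) := by
  have h := jordan_linearized z x y w
  have e1 : z * (x * y * w) = x * y * w * z := mul_comm _ _
  have e2 : x * (y * z * w) = x * (w * (y * z)) := by rw [mul_comm w]
  have e3 : y * (z * x * w) = y * (w * (x * z)) := by rw [mul_comm w, mul_comm z x]
  have e4 : x * y * (z * w) = x * y * (w * z) := by rw [mul_comm z w]
  have e5 : y * z * (x * w) = x * w * (y * z) := mul_comm _ _
  have e6 : z * x * (y * w) = y * w * (x * z) := by rw [mul_comm, mul_comm z x]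
  rw [e1, e2, e3, e4, e5, e6] at h
  rw [eq_sub_iff_add_eq, eq_sub_iff_add_eq,
    show x * y * w * z + x * (w * (y * z)) + y * (w * (x * z))
      = x * y * (w * z) + x * w * (y * z) + y * w * (x * z) from h]
  abel

end JordanIdentities

/-! ### Power associativity -/

section Powers

variable {J : Type*} [NonAssocCommRing J] [Module ℝ J] [SMulCommClass ℝ J J]

/-- The operators `L(x)` and `L(x²)` commute with every `L(xⁿ)`: by `mul_mul_mul_eq`, `L(xⁿ⁺²)` is
a polynomial in `L(x)`, `L(x²)`, `L(xⁿ)` and `L(xⁿ⁺¹)`. -/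
theorem commute_mulLeft_jpow [IsCommJordan J] (x : J) (n : ℕ) :
    Commute (LinearMap.mulLeft ℝ x) (LinearMap.mulLeft ℝ (jpow x n)) ∧
      Commute (LinearMap.mulLeft ℝ (x * x)) (LinearMap.mulLeft ℝ (jpow x n)) := by
  have hx : Commute (LinearMap.mulLeft ℝ x) (LinearMap.mulLeft ℝ (x * x)) := by
    ext b
    change x * ((x * x) * b) = (x * x) * (x * b)
    have := IsCommJordan.lmul_comm_rmul_rmul x b
    rw [mul_comm (x * x) b, ← this, mul_comm]
  induction n using Nat.strong_induction_on with
  | _ n ih =>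
    match n with
    | 0 =>
      have : LinearMap.mulLeft ℝ (jpow x 0) = 1 := by ext b; exact one_mul b
      rw [this]
      exact ⟨Commute.one_right _, Commute.one_right _⟩
    | 1 =>
      have : jpow x 1 = x := mul_one x
      rw [this]
      exact ⟨Commute.refl _, hx.symm⟩
    | n + 2 =>
      obtain ⟨h1, h2⟩ := ih (n + 1) (by omega)
      obtain ⟨h3, h4⟩ := ih n (by omega)
      have key : LinearMap.mulLeft ℝ (jpow x (n + 2)) =
          LinearMap.mulLeft ℝ (jpow x (n + 1)) * LinearMap.mulLeft ℝ x +
          LinearMap.mulLeft ℝ (jpow x (n + 1)) * LinearMap.mulLeft ℝ x +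
          LinearMap.mulLeft ℝ (x * x) * LinearMap.mulLeft ℝ (jpow x n)
          - LinearMap.mulLeft ℝ (jpow x n) * (LinearMap.mulLeft ℝ x * LinearMap.mulLeft ℝ x)
          - LinearMap.mulLeft ℝ x * (LinearMap.mulLeft ℝ x * LinearMap.mulLeft ℝ (jpow x n)) := by
        ext z
        have h := mul_mul_mul_eq x (jpow x n) x z
        change (x * (x * jpow x n)) * z = (x * jpow x n) * (x * z) + (x * jpow x n) * (x * z)
          + (x * x) * (jpow x n * z) - jpow x n * (x * (x * z)) - x * (x * (jpow x n * z))
        rw [mul_comm x (x * jpow x n), h, mul_comm (jpow x n) x]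
      rw [key]
      have e := Commute.refl (LinearMap.mulLeft ℝ x)
      constructor
      · exact ((((h1.mul_right e).add_right (h1.mul_right e)).add_right
          (hx.mul_right h3)).sub_right (h3.mul_right (e.mul_right e))).sub_right
          (e.mul_right (e.mul_right h3))
      · exact ((((h2.mul_right hx.symm).add_right (h2.mul_right hx.symm)).add_right
          ((Commute.refl _).mul_right h4)).sub_right
          (h4.mul_right (hx.symm.mul_right hx.symm))).sub_right
          (hx.symm.mul_right (hx.symm.mul_right h4))

/-- Power associativity. -/
theorem jpow_mul_jpow [IsCommJordan J] (x : J) (m n : ℕ) :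
    jpow x m * jpow x n = jpow x (m + n) := by
  induction m with
  | zero => rw [Nat.zero_add]; exact one_mul _
  | succ m ih =>
    have h := LinearMap.congr_fun (commute_mulLeft_jpow x n).1.eq (jpow x m)
    change x * (jpow x n * jpow x m) = jpow x n * (x * jpow x m) at h
    rw [show m + 1 + n = (m + n) + 1 by omega]
    change (x * jpow x m) * jpow x n = x * jpow x (m + n)
    rw [← ih, mul_comm (x * jpow x m), ← h, mul_comm (jpow x n)]

/-- The value `p(x)` of a polynomial at an element of a Jordan algebra. -/
noncomputable def polyEval (x : J) (p : Polynomial ℝ) : J :=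
  Polynomial.aeval (LinearMap.mulLeft ℝ x) p 1

theorem polyEval_monomial (x : J) (n : ℕ) (a : ℝ) :
    polyEval x (Polynomial.monomial n a) = a • jpow x n := by
  have h : ∀ n, ((LinearMap.mulLeft ℝ x) ^ n) 1 = jpow x n := by
    intro n
    induction n with
    | zero => rfl
    | succ n ih => rw [pow_succ', Module.End.mul_apply, ih]; rfl
  rw [polyEval, Polynomial.aeval_monomial, Module.End.mul_apply, Module.algebraMap_end_apply, h]

theorem polyEval_add (x : J) (p q : Polynomial ℝ) :
    polyEval x (p + q) = polyEval x p + polyEval x q := by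
  rw [polyEval, map_add]; rfl

theorem polyEval_mem_polySpan (x : J) (p : Polynomial ℝ) : polyEval x p ∈ polySpan x := by
  induction p using Polynomial.induction_on' with
  | add p q hp hq => rw [polyEval_add]; exact add_mem hp hq
  | monomial n a =>
    rw [polyEval_monomial]
    exact Submodule.smul_mem _ _ (Submodule.subset_span ⟨n, rfl⟩)

theorem polyEval_mul [IsScalarTower ℝ J J] [IsCommJordan J] (x : J) (p q : Polynomial ℝ) :
    polyEval x (p * q) = polyEval x p * polyEval x q := by
  induction p using Polynomial.induction_on' with
  | add p p' hp hp' => rw [add_mul, polyEval_add, hp, hp', polyEval_add, add_mul]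
  | monomial m a =>
    induction q using Polynomial.induction_on' with
    | add q q' hq hq' => rw [mul_add, polyEval_add, hq, hq', polyEval_add, mul_add]
    | monomial n b =>
      rw [Polynomial.monomial_mul_monomial, polyEval_monomial, polyEval_monomial,
        polyEval_monomial, smul_mul_smul_comm, jpow_mul_jpow]

end Powers

/-! ### Peirce rules for an idempotent -/

section PeirceRules

variable {J : Type*} [NonAssocCommRing J] [Module ℝ J] [IsCommJordan J]

/-- Multiplication by an idempotent `c` satisfies `2 L³ - 3 L² + L = 0`. -/
theorem idem_cubic {c : J} (hc : c * c = c) (z : J) :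
    (2 : ℝ) • (c * (c * (c * z))) = (3 : ℝ) • (c * (c * z)) - c * z := by
  have h := mul_mul_mul_eq c c c z
  simp only [hc] at h
  have : (2 : ℝ) • (c * (c * (c * z))) - ((3 : ℝ) • (c * (c * z)) - c * z) =
    c * z - (c * (c * z) + c * (c * z) + c * (c * z) - c * (c * (c * z)) - c * (c * (c * z))) := by
    module
  rw [← sub_eq_zero, this, ← h, sub_self]

/-- If `c a = 0` for an idempotent `c`, then multiplications by `a` and by `c` commute. -/
theorem mul_left_comm_of_peirceZero {c a : J} (hc : c * c = c) (ha : c * a = 0) (z : J) :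
    c * (a * z) = a * (c * z) := by
  have h := jordan_linearized c c a z
  rw [mul_comm a c, ha, hc] at h
  simpa using h.symm

variable [SMulCommClass ℝ J J]

/-- On the Peirce space `A_½(c)` the map `a ↦ 2 L(a)`, `a ∈ A_0(c)`, is a homomorphism of Jordan
algebras. -/
theorem mul_mul_of_peirceHalf {c a b v : J} (hc : c * c = c) (ha : c * a = 0) (hb : c * b = 0)
    (hv : c * v = (1 / 2 : ℝ) • v) : (a * b) * v = a * (b * v) + b * (a * v) := by
  have h := mul_mul_mul_eq a b c v
  rw [mul_comm (a * b) c, mul_mul_eq_zero_of_peirce hc ha hb, mul_comm b c, mul_comm a c, ha, hb,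
    mul_left_comm_of_peirceZero hc ha, mul_left_comm_of_peirceZero hc hb, hv] at h
  simp only [zero_mul, mul_smul_comm] at h
  apply eq_of_two_smul_eq
  have h' : (4 : ℝ) • ((1 / 2 : ℝ) • (a * b * v) - (1 / 2 : ℝ) • (b * (a * v))
    - (1 / 2 : ℝ) • (a * (b * v))) = 0 := by
    rw [show (1 / 2 : ℝ) • (a * b * v) - (1 / 2 : ℝ) • (b * (a * v)) - (1 / 2 : ℝ) • (a * (b * v))
      = 0 + (1 / 2 : ℝ) • (a * b * v) + 0 - (1 / 2 : ℝ) • (b * (a * v))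
        - (1 / 2 : ℝ) • (a * (b * v)) by module, ← h, smul_zero]
  rw [← sub_eq_zero, ← h']
  module

theorem peirceZero_mul_peirceHalf {c a v : J} (hc : c * c = c) (ha : c * a = 0)
    (hv : c * v = (1 / 2 : ℝ) • v) : c * (a * v) = (1 / 2 : ℝ) • (a * v) := by
  rw [mul_left_comm_of_peirceZero hc ha, hv, mul_smul_comm]

variable [IsScalarTower ℝ J J]

/-- The square of an element of `A_½(c)` has no component in `A_½(c)`. -/
theorem peirceHalf_sq {c v : J} (hc : c * c = c) (hv : c * v = (1 / 2 : ℝ) • v) :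
    c * (c * (v * v)) = c * (v * v) := by
  have h2 := jordan_linearized c v v c
  rw [mul_comm (v * v) c, mul_comm v c, hv, hc] at h2
  simp only [mul_smul_comm, smul_mul_assoc, mul_comm v c, hv, smul_smul] at h2
  rw [mul_comm (v * v) c] at h2
  have h3 : c * (c * (v * v)) + ((1 / 2 : ℝ) * (1 / 2)) • (v * v)
     + ((1 / 2 : ℝ) * (1 / 2)) • (v * v)
     - (((1 / 2 : ℝ) * (1 / 2)) • (v * v) + ((1 / 2 : ℝ) * (1 / 2)) • (v * v)) =
     c * (c * (v * v)) := by abel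
  rw [← h3, h2]
  abel

end PeirceRules

/-! ### Positive definite symmetric bilinear forms -/

section BilinearForms

variable {V : Type*} [AddCommGroup V] [Module ℝ V]

/-- The inner product space structure given by a positive definite symmetric bilinear form. -/
noncomputable abbrev coreOfForm (β : LinearMap.BilinForm ℝ V) (hs : ∀ x y, β x y = β y x)
    (hp : ∀ x, x ≠ 0 → 0 < β x x) : InnerProductSpace.Core ℝ V where
  inner x y := β x y
  conj_inner_symm x y := hs y x
  re_inner_nonneg x := by
    by_cases h : x = 0
    · simp [h]
    · exact (hp x h).le
  add_left x y z := by simp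
  smul_left x y r := by simp
  definite x hx := by
    by_contra h
    exact (hp x h).ne' hx

variable [FiniteDimensional ℝ V]

theorem exists_orthonormal_basis (β : LinearMap.BilinForm ℝ V) (hs : ∀ x y, β x y = β y x)
    (hp : ∀ x, x ≠ 0 → 0 < β x x) :
    ∃ b : Module.Basis (Fin (Module.finrank ℝ V)) ℝ V,
      ∀ i j, β (b i) (b j) = if i = j then 1 else 0 := by
  let _ : NormedAddCommGroup V := (coreOfForm β hs hp).toNormedAddCommGroup
  let _ : InnerProductSpace ℝ V := InnerProductSpace.ofCore (coreOfForm β hs hp).toCore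
  refine ⟨(stdOrthonormalBasis ℝ V).toBasis, fun i j => ?_⟩
  have := orthonormal_iff_ite.mp (stdOrthonormalBasis ℝ V).orthonormal i j
  rw [OrthonormalBasis.coe_toBasis]
  exact this

/-- The spectral theorem for a symmetric operator: a vector is a sum of components `e μ`, each of
them zero or an eigenvector for `μ`. -/
theorem exists_eigenvector_decomposition (β : LinearMap.BilinForm ℝ V)
    (hs : ∀ x y, β x y = β y x) (hp : ∀ x, x ≠ 0 → 0 < β x x) (T : V →ₗ[ℝ] V)
    (hT : ∀ x y, β (T x) y = β x (T y)) (v : V) :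
    ∃ (S : Finset ℝ) (e : ℝ → V), (∀ μ, T (e μ) = μ • e μ) ∧ v = ∑ μ ∈ S, e μ := by
  classical
  let _ : NormedAddCommGroup V := (coreOfForm β hs hp).toNormedAddCommGroup
  let _ : InnerProductSpace ℝ V := InnerProductSpace.ofCore (coreOfForm β hs hp).toCore
  have hT' : T.IsSymmetric := hT
  set b := hT'.eigenvectorBasis rfl
  set lam := hT'.eigenvalues rfl
  have hb : ∀ i, T (b i) = lam i • b i := fun i => hT'.apply_eigenvectorBasis rfl i
  refine ⟨Finset.univ.image lam, fun μ => ∑ i with lam i = μ, b.repr v i • b i, ?_, ?_⟩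
  · intro μ
    rw [map_sum, Finset.smul_sum]
    refine Finset.sum_congr rfl fun i hi => ?_
    rw [map_smul, hb, (Finset.mem_filter.mp hi).2, smul_comm]
  · rw [Finset.sum_fiberwise_of_maps_to (fun i _ => Finset.mem_image_of_mem _ (Finset.mem_univ i))]
    exact (b.sum_repr v).symm

end BilinearForms

/-! ### Euclidean Jordan algebras and the spectral theorem -/

section Euclidean

variable {J : Type*} [NonAssocCommRing J] [Module ℝ J]

/-- A positive definite symmetric associative bilinear form. -/
structure IsEuclideanForm (β : LinearMap.BilinForm ℝ J) : Prop where
  symm : ∀ x y, β x y = β y x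
  pos : ∀ x, x ≠ 0 → 0 < β x x
  assoc : ∀ x y z, β (x * y) z = β y (x * z)

namespace IsEuclideanForm

variable {β : LinearMap.BilinForm ℝ J} (hβ : IsEuclideanForm β)
include hβ

theorem nonneg (x : J) : 0 ≤ β x x := by
  by_cases h : x = 0
  · simp [h]
  · exact (hβ.pos x h).le

theorem eq_zero {x : J} (h : β x x = 0) : x = 0 := by
  by_contra h'
  exact (hβ.pos x h').ne' h

theorem mul_one_right (x y : J) : β (x * y) 1 = β x y := by
  rw [mul_comm, hβ.assoc, mul_one, hβ.symm]

theorem idem_idem_eq {c a : J} (ha : a * a = a) : β c a = β a (c * a) := by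
  rw [hβ.symm a, mul_comm c a, hβ.assoc, ha]

variable [IsCommJordan J]

/-- By the cubic equation, multiplication `L` by an idempotent satisfies `L = L² + 4 (L - L²)²`,
so `L` is positive semidefinite and its quadratic form vanishes only on its kernel. -/
theorem idem_mul_eq {c : J} (hc : c * c = c) (z : J) :
    β z (c * z) = β (c * z) (c * z) +
      4 * β (c * z - c * (c * z)) (c * z - c * (c * z)) := by
  set u := c * z
  have h := idem_cubic hc z
  have h1 : c * (c * (c * z)) = (3 / 2 : ℝ) • (c * u) - (1 / 2 : ℝ) • u := by
    apply eq_of_two_smul_eq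
    rw [h]; module
  have e1 : β u u = β z (c * u) := hβ.assoc c z u
  have e2 : β u (c * u) = β z (c * (c * u)) := hβ.assoc c z (c * u)
  have e3 : β (c * u) (c * u) = β u (c * (c * u)) := hβ.assoc c u (c * u)
  have h1' : c * (c * u) = (3 / 2 : ℝ) • (c * u) - (1 / 2 : ℝ) • u := h1
  rw [h1'] at e2 e3
  simp only [map_sub, map_smul, LinearMap.sub_apply, smul_eq_mul] at *
  rw [hβ.symm (c * u) u, e3, e2, e1]
  ring

theorem idem_mul_nonneg {c : J} (hc : c * c = c) (z : J) : 0 ≤ β z (c * z) := by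
  rw [hβ.idem_mul_eq hc]
  have := hβ.nonneg (c * z)
  have := hβ.nonneg (c * z - c * (c * z))
  linarith

theorem idem_mul_eq_zero {c : J} (hc : c * c = c) {z : J} (h : β z (c * z) = 0) : c * z = 0 := by
  rw [hβ.idem_mul_eq hc] at h
  have := hβ.nonneg (c * z)
  have := hβ.nonneg (c * z - c * (c * z))
  exact hβ.eq_zero (by linarith)

theorem idem_idem_nonneg {c a : J} (hc : c * c = c) (ha : a * a = a) : 0 ≤ β c a := by
  rw [hβ.idem_idem_eq ha]
  exact hβ.idem_mul_nonneg hc a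

theorem idem_idem_eq_zero {c a : J} (hc : c * c = c) (ha : a * a = a) (h : β c a = 0) :
    c * a = 0 :=
  hβ.idem_mul_eq_zero hc (by rw [← hβ.idem_idem_eq ha, h])

/-- An idempotent orthogonal to a sum of two idempotents is orthogonal to each of them. -/
theorem orthogonal_of_add {c a b : J} (hc : c * c = c) (ha : a * a = a) (hb : b * b = b)
    (h : c * (a + b) = 0) : c * a = 0 ∧ c * b = 0 := by
  have h0 : β c (a + b) = 0 := by rw [← hβ.mul_one_right, h]; simp
  rw [map_add] at h0
  have h1 := hβ.idem_idem_nonneg hc ha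
  have h2 := hβ.idem_idem_nonneg hc hb
  exact ⟨hβ.idem_idem_eq_zero hc ha (by linarith), hβ.idem_idem_eq_zero hc hb (by linarith)⟩

end IsEuclideanForm

/-- A complete system of orthogonal nonzero idempotents, not necessarily primitive. -/
structure IsIdempotentSystem {J : Type*} [NonAssocCommRing J] {k : ℕ} (f : Fin k → J) : Prop where
  ne_zero : ∀ i, f i ≠ 0
  idem : ∀ i, f i * f i = f i
  orthogonal : ∀ i j, i ≠ j → f i * f j = 0
  complete : ∑ i, f i = 1

theorem IsJordanFrame.isIdempotentSystem {J : Type*} [NonAssocCommRing J] {k : ℕ} {f : Fin k → J}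
    (hf : IsJordanFrame f) : IsIdempotentSystem f :=
  ⟨fun i => (hf.primitive i).ne_zero, fun i => (hf.primitive i).idem, hf.orthogonal, hf.complete⟩

theorem IsIdempotentSystem.mul_sum [SMulCommClass ℝ J J] {k : ℕ} {f : Fin k → J}
    (hf : IsIdempotentSystem f) (lam : Fin k → ℝ) (i : Fin k) :
    f i * ∑ j, lam j • f j = lam i • f i := by
  rw [Finset.mul_sum, Finset.sum_eq_single i]
  · rw [mul_smul_comm, hf.idem]
  · intro j _ hj
    rw [mul_smul_comm, hf.orthogonal i j hj.symm, smul_zero]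
  · simp

theorem IsIdempotentSystem.sum_mul_sum [SMulCommClass ℝ J J] [IsScalarTower ℝ J J] {k : ℕ}
    {f : Fin k → J} (hf : IsIdempotentSystem f) (lam mu : Fin k → ℝ) :
    (∑ j, lam j • f j) * ∑ j, mu j • f j = ∑ j, (lam j * mu j) • f j := by
  rw [Finset.sum_mul]
  refine Finset.sum_congr rfl fun i _ => ?_
  rw [smul_mul_assoc, hf.mul_sum, smul_smul]

theorem IsIdempotentSystem.linearIndependent [SMulCommClass ℝ J J] {k : ℕ} {f : Fin k → J}
    (hf : IsIdempotentSystem f) : LinearIndependent ℝ f := by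
  rw [Fintype.linearIndependent_iff]
  intro g hg i
  have h := hf.mul_sum g i
  rw [hg, mul_zero] at h
  exact (smul_eq_zero.mp h.symm).resolve_right (hf.ne_zero i)

variable [SMulCommClass ℝ J J] [IsScalarTower ℝ J J] [FiniteDimensional ℝ J] [IsCommJordan J]

/-- The spectral theorem with distinct eigenvalues: the idempotents are the components of the unit
in the eigenspaces of `L(x)`. They are polynomials in `x`, hence orthogonal idempotents. -/
theorem exists_idempotentSystem {β : LinearMap.BilinForm ℝ J} (hβ : IsEuclideanForm β) (x : J) :
    ∃ (k : ℕ) (f : Fin k → J) (lam : Fin k → ℝ), IsIdempotentSystem f ∧ x = ∑ i, lam i • f i := by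
  classical
  obtain ⟨S, e, he, h1⟩ := exists_eigenvector_decomposition β hβ.symm hβ.pos
    (LinearMap.mulLeft ℝ x) (fun y z => hβ.assoc x y z) 1
  have hev : ∀ p : Polynomial ℝ, polyEval x p = ∑ μ ∈ S, p.eval μ • e μ := by
    intro p
    rw [polyEval, h1, map_sum]
    refine Finset.sum_congr rfl fun μ _ => ?_
    induction p using Polynomial.induction_on' with
    | add p q hp hq => rw [map_add, LinearMap.add_apply, hp, hq, Polynomial.eval_add, add_smul]
    | monomial n a =>
      rw [Polynomial.aeval_monomial, Module.End.mul_apply, Module.algebraMap_end_apply,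
        Polynomial.eval_monomial, mul_smul]
      congr 1
      induction n with
      | zero => simp
      | succ n ih => rw [pow_succ', Module.End.mul_apply, ih, map_smul, he, smul_smul, pow_succ]
  have hinj : Set.InjOn (id : ℝ → ℝ) S := Set.injOn_id _
  -- the Lagrange basis polynomials recover the components `e μ` as polynomials in `x`
  have hbasis : ∀ μ ∈ S, ∀ κ ∈ S, (Lagrange.basis S id μ).eval κ = if μ = κ then 1 else 0 := by
    intro μ hμ κ hκ
    split_ifs with h
    · subst h; exact Lagrange.eval_basis_self (v := id) hinj hμ
    · exact Lagrange.eval_basis_of_ne (v := id) h hκ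
  have hproj : ∀ μ ∈ S, polyEval x (Lagrange.basis S id μ) = e μ := by
    intro μ hμ
    rw [hev, Finset.sum_eq_single μ]
    · rw [hbasis μ hμ μ hμ]; simp
    · intro κ hκ h
      rw [hbasis μ hμ κ hκ, if_neg h.symm, zero_smul]
    · exact fun h => absurd hμ h
  have hmul : ∀ μ ∈ S, ∀ κ ∈ S, e μ * e κ = if μ = κ then e μ else 0 := by
    intro μ hμ κ hκ
    rw [← hproj μ hμ, ← hproj κ hκ, ← polyEval_mul, hev, hproj μ hμ, Finset.sum_eq_single μ]
    · rw [Polynomial.eval_mul, hbasis μ hμ μ hμ, hbasis κ hκ μ hμ]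
      by_cases h : μ = κ
      · simp [h]
      · rw [if_neg h, if_neg (Ne.symm h)]; simp
    · intro ρ hρ h
      rw [Polynomial.eval_mul, hbasis μ hμ ρ hρ, if_neg h.symm]; simp
    · exact fun h => absurd hμ h
  -- a chosen component may vanish, so the system consists of the nonzero ones
  set S' := S.filter (fun μ => e μ ≠ 0)
  have hsum : ∀ g : ℝ → ℝ, ∑ μ ∈ S, g μ • e μ = ∑ i : Fin S'.card,
      g (S'.equivFin.symm i) • e (S'.equivFin.symm i) := by
    intro g
    rw [Equiv.sum_comp S'.equivFin.symm (fun μ : S' => g μ • e μ),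
      Finset.sum_coe_sort S' (fun μ => g μ • e μ)]
    refine (Finset.sum_subset (Finset.filter_subset _ _) fun μ hμ h => ?_).symm
    have : e μ = 0 := by
      by_contra h'
      exact h (Finset.mem_filter.mpr ⟨hμ, h'⟩)
    rw [this, smul_zero]
  have hmem : ∀ i, ((S'.equivFin.symm i : S') : ℝ) ∈ S :=
    fun i => (Finset.mem_filter.mp (S'.equivFin.symm i).2).1
  refine ⟨S'.card, fun i => e (S'.equivFin.symm i), fun i => (S'.equivFin.symm i : S'),
    ⟨?_, ?_, ?_, ?_⟩, ?_⟩
  · exact fun i => (Finset.mem_filter.mp (S'.equivFin.symm i).2).2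
  · intro i
    rw [hmul _ (hmem i) _ (hmem i), if_pos rfl]
  · intro i j hij
    rw [hmul _ (hmem i) _ (hmem j), if_neg]
    intro h
    exact hij (S'.equivFin.symm.injective (Subtype.ext h))
  · have := hsum (fun _ => 1)
    simp only [one_smul] at this
    rw [← this, h1]
  · have hx : x = x * 1 := (mul_one x).symm
    rw [← hsum (fun μ => μ), hx, h1, Finset.mul_sum]
    exact Finset.sum_congr rfl fun μ _ => he μ

/-- The spectral theorem: every element is a combination of a complete system of orthogonal
primitive idempotents. A system with the largest possible number of members is primitive, because
a decomposition of one of its members would refine it. -/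
theorem exists_jordanFrame {β : LinearMap.BilinForm ℝ J} (hβ : IsEuclideanForm β) (x : J) :
    ∃ (k : ℕ) (f : Fin k → J) (lam : Fin k → ℝ), IsJordanFrame f ∧ x = ∑ i, lam i • f i := by
  classical
  let P : ℕ → Prop := fun k => ∃ (f : Fin k → J) (lam : Fin k → ℝ),
    IsIdempotentSystem f ∧ x = ∑ i, lam i • f i
  have hbd : ∀ k, P k → k ≤ Module.finrank ℝ J := by
    rintro k ⟨f, lam, hf, -⟩
    simpa using hf.linearIndependent.fintype_card_le_finrank
  obtain ⟨k₀, hk₀⟩ : ∃ k, P k := exists_idempotentSystem hβ x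
  have hP := Nat.findGreatest_spec (P := P) (hbd k₀ hk₀) hk₀
  set k := Nat.findGreatest P (Module.finrank ℝ J)
  obtain ⟨f, lam, hf, hx⟩ := hP
  refine ⟨k, f, lam, ⟨fun i => ⟨hf.ne_zero i, hf.idem i, ?_⟩, hf.orthogonal, hf.complete⟩, hx⟩
  intro a b ha hb hab hsum
  by_contra! hne
  have horth : ∀ j, j ≠ i → f j * a = 0 ∧ f j * b = 0 := fun j hj =>
    hβ.orthogonal_of_add (hf.idem j) ha hb (by rw [hsum, hf.orthogonal j i hj])
  have hsum' : ∀ g : Fin k → ℝ, ∑ j, g j • f j =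
      g i • a + ∑ j, g j • Function.update f i b j := by
    intro g
    rw [← Finset.add_sum_erase _ _ (Finset.mem_univ i),
      ← Finset.add_sum_erase (a := i) Finset.univ (fun j => g j • Function.update f i b j)
        (Finset.mem_univ i), Function.update_self, ← hsum, smul_add, add_assoc]
    congr 2
    refine Finset.sum_congr rfl fun j hj => ?_
    rw [Function.update_of_ne (Finset.ne_of_mem_erase hj)]
  have hP' : P (k + 1) := by
    refine ⟨Fin.cons a (Function.update f i b), Fin.cons (lam i) lam, ⟨?_, ?_, ?_, ?_⟩, ?_⟩
    · refine Fin.cases hne.1 fun j => ?_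
      rw [Fin.cons_succ]
      by_cases h : j = i
      · subst h; rw [Function.update_self]; exact hne.2
      · rw [Function.update_of_ne h]; exact hf.ne_zero j
    · refine Fin.cases ha fun j => ?_
      rw [Fin.cons_succ]
      by_cases h : j = i
      · subst h; rw [Function.update_self]; exact hb
      · rw [Function.update_of_ne h]; exact hf.idem j
    · have key : ∀ j, a * Function.update f i b j = 0 := by
        intro j
        by_cases h : j = i
        · subst h; rw [Function.update_self]; exact hab
        · rw [Function.update_of_ne h, mul_comm]; exact (horth j h).1
      refine Fin.cases ?_ fun j => ?_
      · refine Fin.cases (fun h => absurd rfl h) fun j _ => ?_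
        simpa using key j
      · refine Fin.cases (fun _ => ?_) fun l hl => ?_
        · rw [mul_comm]; simpa using key j
        · have hl' : j ≠ l := fun h => hl (by rw [h])
          rw [Fin.cons_succ, Fin.cons_succ]
          by_cases h : j = i
          · subst h
            rw [Function.update_self, Function.update_of_ne hl'.symm, mul_comm]
            exact (horth l hl'.symm).2
          · rw [Function.update_of_ne h]
            by_cases h' : l = i
            · subst h'; rw [Function.update_self]; exact (horth j h).2
            · rw [Function.update_of_ne h']; exact hf.orthogonal j l hl'
    · rw [Fin.sum_univ_succ]
      have := hsum' (fun _ => 1)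
      simp only [one_smul, hf.complete] at this
      simpa using this.symm
    · rw [Fin.sum_univ_succ, hx, hsum']
      simp
  have := Nat.le_findGreatest (hbd _ hP') hP'
  omega

end Euclidean

/-! ### Peirce spaces of primitive idempotents -/

section PeirceEuclidean

theorem one_sub_idem {J : Type*} [NonAssocCommRing J] {c : J} (hc : c * c = c) :
    (1 - c) * (1 - c) = 1 - c := by
  rw [mul_sub, mul_one, sub_mul, one_mul, hc, sub_self, sub_zero]

variable {J : Type*} [NonAssocCommRing J] [Module ℝ J] [SMulCommClass ℝ J J]
  [IsCommJordan J]

instance [FiniteDimensional ℝ J] (c : J) (hc : c * c = c) :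
    FiniteDimensional ℝ (peirceZero c hc) :=
  inferInstanceAs (FiniteDimensional ℝ (peirceZero c hc).toSubmodule)

/-- The restriction of a bilinear form to a Peirce subalgebra. -/
noncomputable def restrictForm (β : LinearMap.BilinForm ℝ J) (c : J) (hc : c * c = c) :
    LinearMap.BilinForm ℝ (peirceZero c hc) :=
  β.compl₁₂ (peirceZero c hc).toSubmodule.subtype (peirceZero c hc).toSubmodule.subtype

theorem IsEuclideanForm.restrictForm {β : LinearMap.BilinForm ℝ J} (hβ : IsEuclideanForm β)
    (c : J) (hc : c * c = c) : IsEuclideanForm (restrictForm β c hc) where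
  symm x y := hβ.symm x y
  pos x hx := hβ.pos x (fun h => hx (Subtype.ext h))
  assoc x y z := hβ.assoc x y z

theorem coe_one_peirceZero (c : J) (hc : c * c = c) :
    ((1 : peirceZero c hc) : J) = 1 - c := rfl

theorem mul_eq_zero_of_peirceZero_mem {c : J} {hc : c * c = c} (x : peirceZero c hc) :
    c * (x : J) = 0 := x.2

theorem coe_sum_smul_peirceZero {c : J} (hc : c * c = c) {k : ℕ} (lam : Fin k → ℝ)
    (f : Fin k → peirceZero c hc) :
    ((∑ i, lam i • f i : peirceZero c hc) : J) = ∑ i, lam i • (f i : J) :=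
  map_sum (peirceZero c hc).toSubmodule.subtype _ _

/-- If `c` is primitive then `A_1(c) = ℝ c`. -/
theorem exists_eq_smul_of_peirceOne [IsScalarTower ℝ J J] [FiniteDimensional ℝ J]
    {β : LinearMap.BilinForm ℝ J} (hβ : IsEuclideanForm β)
    {c : J} (hc : IsPrimitiveIdempotent c) {x : J} (hx : c * x = x) : ∃ t : ℝ, x = t • c := by
  have hc' := one_sub_idem hc.idem
  have hmem : (1 - c) * x = 0 := by rw [sub_mul, one_mul, hx, sub_self]
  obtain ⟨k, f, lam, hf, hxf⟩ := exists_idempotentSystem (hβ.restrictForm (1 - c) hc')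
    (⟨x, hmem⟩ : peirceZero (1 - c) hc')
  have hfc : ∀ i, (f i : J) = c := by
    intro i
    have h1 : c * (f i : J) = f i := by
      have := mul_eq_zero_of_peirceZero_mem (f i)
      rw [sub_mul, one_mul, sub_eq_zero] at this
      exact this.symm
    have h2 : (f i : J) * f i = f i := congrArg Subtype.val (hf.idem i)
    rcases hc.primitive (f i) (c - f i) h2
      (by rw [mul_sub, sub_mul, sub_mul, hc.idem, mul_comm _ c, h1, h2]; abel)
      (by rw [mul_sub, mul_comm _ c, h1, h2, sub_self]) (by abel) with h | h
    · exact absurd (Subtype.ext h) (hf.ne_zero i)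
    · exact (sub_eq_zero.mp h).symm
  refine ⟨∑ i, lam i, ?_⟩
  have := congrArg Subtype.val hxf
  rw [coe_sum_smul_peirceZero] at this
  change x = _ at this
  rw [this, Finset.sum_smul]
  exact Finset.sum_congr rfl fun i _ => by rw [hfc]

theorem IsPrimitiveIdempotent.of_peirceZero {β : LinearMap.BilinForm ℝ J}
    (hβ : IsEuclideanForm β) {c : J} (hc : c * c = c)
    {f : peirceZero c hc} (hf : IsPrimitiveIdempotent f) : IsPrimitiveIdempotent (f : J) where
  ne_zero h := hf.ne_zero (Subtype.ext h)
  idem := congrArg Subtype.val hf.idem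
  primitive a b ha hb hab h := by
    obtain ⟨h1, h2⟩ := hβ.orthogonal_of_add hc ha hb (by rw [h]; exact f.2)
    rcases hf.primitive ⟨a, h1⟩ ⟨b, h2⟩ (Subtype.ext ha) (Subtype.ext hb) (Subtype.ext hab)
      (Subtype.ext h) with h | h
    · exact Or.inl (congrArg Subtype.val h)
    · exact Or.inr (congrArg Subtype.val h)

/-- A complete system of orthogonal primitive idempotents of `A_0(c)`, together with `c`, is one
of `A`. -/
theorem IsJordanFrame.snoc {β : LinearMap.BilinForm ℝ J} (hβ : IsEuclideanForm β) {c : J}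
    (hc : IsPrimitiveIdempotent c) {k : ℕ} {f : Fin k → peirceZero c hc.idem}
    (hf : IsJordanFrame f) :
    IsJordanFrame (Fin.snoc (fun i => (f i : J)) c : Fin (k + 1) → J) where
  primitive := by
    refine Fin.lastCases ?_ fun i => ?_
    · simpa using hc
    · simpa using (hf.primitive i).of_peirceZero hβ hc.idem
  orthogonal := by
    refine Fin.lastCases ?_ fun i => ?_
    · refine Fin.lastCases (fun h => absurd rfl h) fun j _ => ?_
      simpa using mul_eq_zero_of_peirceZero_mem (f j)
    · refine Fin.lastCases (fun _ => ?_) fun j hij => ?_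
      · rw [mul_comm]; simpa using mul_eq_zero_of_peirceZero_mem (f i)
      · have := hf.orthogonal i j (fun h => hij (by rw [h]))
        simpa using congrArg Subtype.val this
  complete := by
    rw [Fin.sum_univ_castSucc]
    have h := congrArg Subtype.val hf.complete
    have h2 := coe_sum_smul_peirceZero hc.idem (fun _ => 1) f
    simp only [one_smul] at h2
    rw [h2, coe_one_peirceZero] at h
    simp [h]

/-- If `u` lies in `A_½(a) ∩ A_½(b)` and `u²` in `ℝ a + ℝ b`, then `u²` is a multiple of `a + b`:
the Jordan identity equates the two coefficients. -/
theorem exists_sq_eq_smul_add [IsScalarTower ℝ J J] [FiniteDimensional ℝ J]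
    {β : LinearMap.BilinForm ℝ J} (hβ : IsEuclideanForm β) {a b u : J}
    (hpa : IsPrimitiveIdempotent a) (hpb : IsPrimitiveIdempotent b)
    (ha : a * u = (1 / 2 : ℝ) • u) (hb : b * u = (1 / 2 : ℝ) • u)
    (hab : a * (u * u) + b * (u * u) = u * u) :
    ∃ α : ℝ, (u ≠ 0 → 0 < α) ∧ u * u = α • (a + b) := by
  by_cases hu : u = 0
  · exact ⟨0, fun h => absurd hu h, by rw [hu]; simp⟩
  obtain ⟨t, ht⟩ := exists_eq_smul_of_peirceOne hβ hpa (peirceHalf_sq hpa.idem ha)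
  obtain ⟨s, hs⟩ := exists_eq_smul_of_peirceOne hβ hpb (peirceHalf_sq hpb.idem hb)
  have j1 := IsCommJordan.lmul_comm_rmul_rmul u a
  have j2 := IsCommJordan.lmul_comm_rmul_rmul u b
  rw [ht, mul_comm u a, ha, smul_mul_assoc, mul_smul_comm, mul_comm u a, ha] at j1
  rw [hs, mul_comm u b, hb, smul_mul_assoc, mul_smul_comm, mul_comm u b, hb, j1] at j2
  rw [smul_smul, smul_smul] at j2
  have hts : t = s := by
    have := smul_left_injective ℝ hu j2
    linarith
  refine ⟨t, fun _ => ?_, by rw [← hab, ht, hs, hts, smul_add]⟩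
  have hpos : t * β a a = (1 / 2) * β u u := by
    have e1 : β (a * (u * u)) a = t * β a a := by rw [ht]; simp
    have e2 : β (a * (u * u)) a = (1 / 2) * β u u := by
      rw [hβ.assoc, hpa.idem, hβ.assoc, mul_comm u a, ha]; simp
    rw [← e1, e2]
  have h1 := hβ.pos a hpa.ne_zero
  have h2 := hβ.pos u hu
  by_contra! hneg
  nlinarith

end PeirceEuclidean

/-! ### Complete systems of three primitive idempotents in a simple algebra -/

section Triples

variable {J : Type*} [NonAssocCommRing J]

/-- A complete system of three orthogonal primitive idempotents. -/
structure IsTriple (a b c : J) : Prop where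
  prim₁ : IsPrimitiveIdempotent a
  prim₂ : IsPrimitiveIdempotent b
  prim₃ : IsPrimitiveIdempotent c
  orth₁₂ : a * b = 0
  orth₁₃ : a * c = 0
  orth₂₃ : b * c = 0
  sum : a + b + c = 1

theorem IsJordanFrame.isTriple {f : Fin 3 → J} (hf : IsJordanFrame f) :
    IsTriple (f 0) (f 1) (f 2) where
  prim₁ := hf.primitive 0
  prim₂ := hf.primitive 1
  prim₃ := hf.primitive 2
  orth₁₂ := hf.orthogonal 0 1 (by decide)
  orth₁₃ := hf.orthogonal 0 2 (by decide)
  orth₂₃ := hf.orthogonal 1 2 (by decide)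
  sum := by rw [← hf.complete, Fin.sum_univ_three]

namespace IsTriple

variable {a b c : J} (h : IsTriple a b c)

include h

theorem swap₁₂ : IsTriple b a c :=
  ⟨h.prim₂, h.prim₁, h.prim₃, by rw [mul_comm, h.orth₁₂], h.orth₂₃, h.orth₁₃,
    by rw [add_comm b, h.sum]⟩

theorem swap₂₃ : IsTriple a c b :=
  ⟨h.prim₁, h.prim₃, h.prim₂, h.orth₁₃, h.orth₁₂, by rw [mul_comm, h.orth₂₃],
    by rw [add_right_comm, h.sum]⟩

theorem sum_mul (x : J) : a * x + b * x + c * x = x := by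
  rw [← add_mul, ← add_mul, h.sum, one_mul]

variable [Module ℝ J]

theorem mul_eq_zero {u : J} (ha : a * u = (1 / 2 : ℝ) • u) (hb : b * u = (1 / 2 : ℝ) • u) :
    c * u = 0 := by
  have := h.sum_mul u
  rw [ha, hb, ← add_smul] at this
  norm_num at this
  exact this

variable [SMulCommClass ℝ J J] [IsScalarTower ℝ J J] [IsCommJordan J]

/-- The square of a nonzero element of `A_½(a) ∩ A_½(b)` is a positive multiple of `a + b`. -/
theorem exists_sq_eq [FiniteDimensional ℝ J] {β : LinearMap.BilinForm ℝ J}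
    (hβ : IsEuclideanForm β) {u : J} (hu : u ≠ 0) (ha : a * u = (1 / 2 : ℝ) • u)
    (hb : b * u = (1 / 2 : ℝ) • u) : ∃ α : ℝ, 0 < α ∧ u * u = α • (a + b) := by
  have hc := h.mul_eq_zero ha hb
  have hc2 : c * (u * u) = 0 := mul_mul_eq_zero_of_peirce h.prim₃.idem hc hc
  obtain ⟨α, hα, hsq⟩ := exists_sq_eq_smul_add hβ h.prim₁ h.prim₂ ha hb
    (by have := h.sum_mul (u * u); rwa [hc2, add_zero] at this)
  exact ⟨α, hα hu, hsq⟩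

/-- Suppose `A_½(a) ∩ A_½(b) = 0` and `0 ≠ w ∈ A_½(a) ∩ A_½(c)`. Then `A_½(b) ∩ A_½(c) = 0`: for
`z` in this space, `w z` lies in `A_½(a) ∩ A_½(b)`, so that `w² z = 2 w (w z) = 0`, while `w²` is
a positive multiple of `a + c` and acts on `z` as a positive scalar. -/
theorem eq_zero_of_offDiagonal [FiniteDimensional ℝ J] {β : LinearMap.BilinForm ℝ J}
    (hβ : IsEuclideanForm β)
    (hab : ∀ u, a * u = (1 / 2 : ℝ) • u → b * u = (1 / 2 : ℝ) • u → u = 0)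
    {w z : J} (hw : w ≠ 0) (haw : a * w = (1 / 2 : ℝ) • w) (hcw : c * w = (1 / 2 : ℝ) • w)
    (hbz : b * z = (1 / 2 : ℝ) • z) (hcz : c * z = (1 / 2 : ℝ) • z) : z = 0 := by
  obtain ⟨α, hα, hsq⟩ := h.swap₂₃.exists_sq_eq hβ hw haw hcw
  have hbw : b * w = 0 := h.swap₂₃.mul_eq_zero haw hcw
  have haz : a * z = 0 := h.swap₁₂.swap₂₃.mul_eq_zero hbz hcz
  have hba : b * a = 0 := by rw [mul_comm, h.orth₁₂]
  have hb := peirceZero_mul_peirceHalf h.prim₂.idem hbw hbz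
  have ha := mul_mul_of_peirceHalf h.prim₂.idem hbw hba hbz
  rw [haz, mul_zero, zero_add, mul_comm w a, haw, smul_mul_assoc] at ha
  have hwz := hab (w * z) ha.symm hb
  have hww := mul_mul_of_peirceHalf h.prim₂.idem hbw hbw hbz
  rw [hwz, mul_zero, add_zero, hsq, smul_mul_assoc, add_mul, haz, hcz, zero_add, smul_smul] at hww
  exact (smul_eq_zero.mp hww).resolve_left (by positivity)

/-- In a simple algebra, no member of a complete system is decoupled from the other two:
otherwise `A_½(a) = 0`, and `ℝ a` is a proper nonzero ideal. -/
theorem not_decoupled [FiniteDimensional ℝ J] [IsSimpleRing J] {β : LinearMap.BilinForm ℝ J}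
    (hβ : IsEuclideanForm β)
    (hab : ∀ u, a * u = (1 / 2 : ℝ) • u → b * u = (1 / 2 : ℝ) • u → u = 0)
    (hac : ∀ u, a * u = (1 / 2 : ℝ) • u → c * u = (1 / 2 : ℝ) • u → u = 0) : False := by
  have hhalf : ∀ v, a * v = (1 / 2 : ℝ) • v → v = 0 := by
    intro v hv
    have hb := mul_mul_of_peirceHalf h.prim₁.idem h.orth₁₂ h.orth₁₂ hv
    have hc := mul_mul_of_peirceHalf h.prim₁.idem h.orth₁₃ h.orth₁₃ hv
    rw [h.prim₂.idem, ← two_smul ℝ] at hb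
    rw [h.prim₃.idem, ← two_smul ℝ] at hc
    have hb0 := hab (b * v) (peirceZero_mul_peirceHalf h.prim₁.idem h.orth₁₂ hv)
      (by rw [hb, smul_smul, ← hb]; norm_num)
    have hc0 := hac (c * v) (peirceZero_mul_peirceHalf h.prim₁.idem h.orth₁₃ hv)
      (by rw [hc, smul_smul, ← hc]; norm_num)
    have := h.sum_mul v
    rw [hv, hb0, hc0, add_zero, add_zero] at this
    have h' : (1 / 2 : ℝ) • v = 0 := by
      rw [show (1 / 2 : ℝ) • v = v - (1 / 2 : ℝ) • v by module, this, sub_self]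
    exact (smul_eq_zero.mp h').resolve_left (by norm_num)
  -- without a component in `A_½(a)`, the product `a x` lies in `A_1(a)`
  have hmul : ∀ x, ∃ t : ℝ, a * x = t • a := by
    intro x
    have h0 := hhalf (a * x - a * (a * x)) (by
      rw [mul_sub]
      apply eq_of_two_smul_eq
      rw [smul_sub, idem_cubic h.prim₁.idem x]
      module)
    exact exists_eq_smul_of_peirceOne hβ h.prim₁ (sub_eq_zero.mp h0).symm
  let I : TwoSidedIdeal J := TwoSidedIdeal.mk' {x | ∃ t : ℝ, x = t • a} ⟨0, by simp⟩
    (by rintro _ _ ⟨s, rfl⟩ ⟨t, rfl⟩; exact ⟨s + t, by rw [add_smul]⟩)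
    (by rintro _ ⟨s, rfl⟩; exact ⟨-s, by rw [neg_smul]⟩)
    (by
      rintro x _ ⟨s, rfl⟩
      obtain ⟨t, ht⟩ := hmul x
      exact ⟨s * t, by rw [mul_smul_comm, mul_comm, ht, smul_smul]⟩)
    (by
      rintro _ x ⟨s, rfl⟩
      obtain ⟨t, ht⟩ := hmul x
      exact ⟨s * t, by rw [smul_mul_assoc, ht, smul_smul]⟩)
  have hI : ∀ x, x ∈ I ↔ ∃ t : ℝ, x = t • a := fun x => TwoSidedIdeal.mem_mk' _ _ _ _ _ _ _
  rcases eq_bot_or_eq_top I with hbot | htop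
  · have : a ∈ I := (hI a).mpr ⟨1, by simp⟩
    rw [hbot, TwoSidedIdeal.mem_bot] at this
    exact h.prim₁.ne_zero this
  · have : (1 : J) ∈ I := by rw [htop]; trivial
    obtain ⟨t, ht⟩ := (hI 1).mp this
    refine h.prim₂.ne_zero ?_
    rw [← one_mul b, ht, smul_mul_assoc, h.orth₁₂, smul_zero]

/-- In a simple Euclidean Jordan algebra of rank three the off-diagonal Peirce spaces are
nonzero. If `A_½(a) ∩ A_½(b) = 0`, then one of the other two off-diagonal spaces vanishes as well,
and a member of the system is decoupled. -/
theorem exists_offDiagonal [FiniteDimensional ℝ J] [IsSimpleRing J] {β : LinearMap.BilinForm ℝ J}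
    (hβ : IsEuclideanForm β) :
    ∃ (u : J) (α : ℝ), a * u = (1 / 2 : ℝ) • u ∧ b * u = (1 / 2 : ℝ) • u ∧ 0 < α ∧
      u * u = α • (a + b) := by
  suffices hu : ∃ u, u ≠ 0 ∧ a * u = (1 / 2 : ℝ) • u ∧ b * u = (1 / 2 : ℝ) • u by
    obtain ⟨u, hu, ha, hb⟩ := hu
    obtain ⟨α, hα, hsq⟩ := h.exists_sq_eq hβ hu ha hb
    exact ⟨u, α, ha, hb, hα, hsq⟩
  by_contra! hno
  have hab : ∀ u, a * u = (1 / 2 : ℝ) • u → b * u = (1 / 2 : ℝ) • u → u = 0 := by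
    intro u h1 h2
    by_contra h3
    exact hno u h3 h1 h2
  by_cases hac : ∀ u, a * u = (1 / 2 : ℝ) • u → c * u = (1 / 2 : ℝ) • u → u = 0
  · exact h.not_decoupled hβ hab hac
  · push Not at hac
    obtain ⟨w, haw, hcw, hw⟩ := hac
    exact h.swap₁₂.not_decoupled hβ (fun u h1 h2 => hab u h2 h1)
      (fun z hbz hcz => h.eq_zero_of_offDiagonal hβ hab hw haw hcw hbz hcz)

/-- An associative bilinear form takes the same value on all members of a complete system: for
an off-diagonal `u` with `u² = α (a + b)`, associativity gives
`α τ(a, 1) = τ(a u², 1) = ½ τ(u, u) = τ(b u², 1) = α τ(b, 1)`. -/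
theorem form_eq [FiniteDimensional ℝ J] [IsSimpleRing J] {β : LinearMap.BilinForm ℝ J}
    (hβ : IsEuclideanForm β) {τ : LinearMap.BilinForm ℝ J}
    (hτ : ∀ x y z, τ (x * y) z = τ y (x * z)) : τ a 1 = τ b 1 := by
  obtain ⟨u, α, ha, hb, hα, hsq⟩ := h.exists_offDiagonal hβ
  have ea : τ (a * (u * u)) 1 = (1 / 2) * τ u u := by
    rw [hτ, mul_one, hτ, mul_comm u a, ha]; simp
  have eb : τ (b * (u * u)) 1 = (1 / 2) * τ u u := by
    rw [hτ, mul_one, hτ, mul_comm u b, hb]; simp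
  rw [hsq, mul_smul_comm, mul_add, h.prim₁.idem, h.orth₁₂, add_zero] at ea
  rw [hsq, mul_smul_comm, mul_add, h.prim₂.idem, mul_comm b a, h.orth₁₂, zero_add] at eb
  simp only [map_smul, LinearMap.smul_apply, smul_eq_mul] at ea eb
  exact mul_left_cancel₀ hα.ne' (by rw [ea, eb])

theorem form_eq_third [FiniteDimensional ℝ J] [IsSimpleRing J] {β : LinearMap.BilinForm ℝ J}
    (hβ : IsEuclideanForm β) {τ : LinearMap.BilinForm ℝ J}
    (hτ : ∀ x y z, τ (x * y) z = τ y (x * z)) : τ a 1 = τ 1 1 / 3 := by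
  have h1 := h.form_eq hβ hτ
  have h2 := h.swap₂₃.form_eq hβ hτ
  have h3 : τ 1 1 = τ a 1 + τ b 1 + τ c 1 := by
    rw [← LinearMap.add_apply, ← LinearMap.add_apply, ← map_add, ← map_add, h.sum]
  linarith

end IsTriple

end Triples

/-! ### The rank and the number of members of a complete system -/

section Rank

variable {J : Type*} [NonAssocCommRing J] [Module ℝ J] [SMulCommClass ℝ J J]
  [IsScalarTower ℝ J J]

theorem IsIdempotentSystem.jpow_sum {k : ℕ} {f : Fin k → J} (hf : IsIdempotentSystem f)
    (lam : Fin k → ℝ) (n : ℕ) : jpow (∑ i, lam i • f i) n = ∑ i, lam i ^ n • f i := by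
  induction n with
  | zero => simp [jpow, hf.complete]
  | succ n ih =>
    change (∑ i, lam i • f i) * jpow _ n = _
    rw [ih, hf.sum_mul_sum]
    simp only [pow_succ']

theorem IsIdempotentSystem.polyEval_sum {k : ℕ} {f : Fin k → J} (hf : IsIdempotentSystem f)
    (lam : Fin k → ℝ) (p : Polynomial ℝ) :
    polyEval (∑ i, lam i • f i) p = ∑ i, p.eval (lam i) • f i := by
  induction p using Polynomial.induction_on' with
  | add p q hp hq =>
    simp only [polyEval_add, hp, hq, Polynomial.eval_add, add_smul, Finset.sum_add_distrib]
  | monomial n a =>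
    simp only [polyEval_monomial, hf.jpow_sum, Polynomial.eval_monomial, Finset.smul_sum, mul_smul]

/-- The element `∑ i • f i` has distinct eigenvalues, so by Lagrange interpolation every `f i` is
a polynomial in it. -/
theorem IsIdempotentSystem.le_finrank_polySpan [FiniteDimensional ℝ J] {k : ℕ} {f : Fin k → J}
    (hf : IsIdempotentSystem f) :
    k ≤ Module.finrank ℝ (polySpan (∑ i : Fin k, ((i : ℕ) : ℝ) • f i)) := by
  classical
  have hmem : ∀ i, f i ∈ polySpan (∑ i : Fin k, ((i : ℕ) : ℝ) • f i) := by
    intro i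
    have hinj : Set.InjOn (fun i : Fin k => ((i : ℕ) : ℝ)) (Finset.univ : Finset (Fin k)) := by
      intro a _ b _ hab
      exact Fin.ext (Nat.cast_injective hab)
    have h := polyEval_mem_polySpan (∑ i : Fin k, ((i : ℕ) : ℝ) • f i)
      (Lagrange.basis Finset.univ (fun i : Fin k => ((i : ℕ) : ℝ)) i)
    have hsum : ∑ j : Fin k, (Lagrange.basis Finset.univ (fun i : Fin k => ((i : ℕ) : ℝ)) i).eval
        ((j : ℕ) : ℝ) • f j = f i := by
      rw [Finset.sum_eq_single i]
      · rw [Lagrange.eval_basis_self (v := fun i : Fin k => ((i : ℕ) : ℝ)) hinj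
          (Finset.mem_univ i), one_smul]
      · intro j _ hj
        rw [Lagrange.eval_basis_of_ne (v := fun i : Fin k => ((i : ℕ) : ℝ)) hj.symm
          (Finset.mem_univ j), zero_smul]
      · simp
    rwa [hf.polyEval_sum, hsum] at h
  have hli : LinearIndependent ℝ
      (fun i => (⟨f i, hmem i⟩ : polySpan (∑ i : Fin k, ((i : ℕ) : ℝ) • f i))) :=
    LinearIndependent.of_comp (Submodule.subtype _) hf.linearIndependent
  simpa using hli.fintype_card_le_finrank

theorem finrank_polySpan_le_jrank {J : Type*} [NonAssocCommRing J] [Module ℝ J]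
    [FiniteDimensional ℝ J] (x : J) :
    Module.finrank ℝ (polySpan x) ≤ jrank J :=
  le_ciSup (f := fun x : J => Module.finrank ℝ (polySpan x))
    ⟨Module.finrank ℝ J, by rintro _ ⟨y, rfl⟩; exact Submodule.finrank_le _⟩ x

theorem finrank_polySpan_le_two {J : Type*} [NonAssocCommRing J] [Module ℝ J]
    [SMulCommClass ℝ J J] {x : J} {p q : ℝ} (h : x * x = p • x + q • 1) :
    Module.finrank ℝ (polySpan x) ≤ 2 := by
  classical
  have hle : polySpan x ≤ Submodule.span ℝ {1, x} := by
    rw [polySpan, Submodule.span_le]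
    rintro _ ⟨n, rfl⟩
    change jpow x n ∈ Submodule.span ℝ {1, x}
    induction n with
    | zero => exact Submodule.subset_span (by simp [jpow])
    | succ n ih =>
      obtain ⟨s, t, hst⟩ := Submodule.mem_span_pair.mp ih
      change x * jpow x n ∈ _
      rw [← hst]
      refine Submodule.mem_span_pair.mpr ⟨t * q, s + t * p, ?_⟩
      rw [mul_add, mul_smul_comm, mul_smul_comm, h, mul_one]
      module
  have hfin : FiniteDimensional ℝ (Submodule.span ℝ {1, x}) :=
    FiniteDimensional.span_of_finite ℝ (Set.toFinite _)
  refine (Submodule.finrank_mono hle).trans ?_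
  have := finrank_span_finset_le_card (R := ℝ) ({1, x} : Finset J)
  rw [Finset.coe_pair] at this
  exact this.trans Finset.card_le_two

variable [FiniteDimensional ℝ J] [IsCommJordan J]

theorem idem_peirceHalf_component {J : Type*} [NonAssocCommRing J] [Module ℝ J]
    [IsCommJordan J] {c : J} (hc : c * c = c) (x : J) :
    c * (c * x - c * (c * x)) = (1 / 2 : ℝ) • (c * x - c * (c * x)) := by
  rw [mul_sub]
  apply eq_of_two_smul_eq
  rw [smul_sub, idem_cubic hc x]
  module

theorem idem_peirceOne_component {J : Type*} [NonAssocCommRing J] [Module ℝ J]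
    [SMulCommClass ℝ J J] [IsCommJordan J] {c : J} (hc : c * c = c) (x : J) :
    c * ((2 : ℝ) • (c * (c * x)) - c * x) = (2 : ℝ) • (c * (c * x)) - c * x := by
  rw [mul_sub, mul_smul_comm, idem_cubic hc x]
  module

/-- If there is a complete system of at most two orthogonal primitive idempotents, then every
element satisfies a quadratic equation. -/
theorem exists_quadratic {β : LinearMap.BilinForm ℝ J} (hβ : IsEuclideanForm β) {k : ℕ}
    (hk : k ≤ 2) {f : Fin k → J} (hf : IsJordanFrame f) (x : J) :
    ∃ p q : ℝ, x * x = p • x + q • 1 := by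
  interval_cases k
  · have h1 : (1 : J) = 0 := by rw [← hf.complete]; simp
    exact ⟨0, 0, by rw [← one_mul x, h1]; simp⟩
  · have h1 : f 0 = 1 := by rw [← hf.complete]; simp
    obtain ⟨t, ht⟩ := exists_eq_smul_of_peirceOne hβ (hf.primitive 0) (x := x)
      (by rw [h1, one_mul])
    refine ⟨t, 0, ?_⟩
    conv_lhs => rw [ht, h1, smul_mul_assoc, one_mul]
    simp [ht, h1]
  · have hsum : f 0 + f 1 = 1 := by rw [← hf.complete, Fin.sum_univ_two]
    have pa := hf.primitive 0
    have pb := hf.primitive 1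
    have hab := hf.orthogonal 0 1 (by decide)
    set a := f 0
    set b := f 1
    have hb : ∀ z, b * z = z - a * z := by
      intro z
      rw [eq_sub_iff_add_eq, ← add_mul, add_comm, hsum, one_mul]
    set u := (4 : ℝ) • (a * x - a * (a * x)) with hu
    have hau : a * u = (1 / 2 : ℝ) • u := by
      rw [hu, mul_smul_comm, idem_peirceHalf_component pa.idem, smul_comm]
    have hbu : b * u = (1 / 2 : ℝ) • u := by rw [hb, hau]; module
    obtain ⟨α, -, hα⟩ := exists_sq_eq_smul_add hβ pa pb hau hbu (by rw [hb]; abel)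
    obtain ⟨s, hs⟩ := exists_eq_smul_of_peirceOne hβ pa (idem_peirceOne_component pa.idem x)
    obtain ⟨t, ht⟩ := exists_eq_smul_of_peirceOne hβ pb (idem_peirceOne_component pb.idem x)
    have hx : x = s • a + u + t • b := by
      rw [← hs, ← ht, hu]
      simp only [hb, mul_sub]
      module
    refine ⟨s + t, α - s * t, ?_⟩
    have hua : u * a = (1 / 2 : ℝ) • u := by rw [mul_comm, hau]
    have hub : u * b = (1 / 2 : ℝ) • u := by rw [mul_comm, hbu]
    have hba : b * a = 0 := by rw [mul_comm, hab]
    rw [hx, ← hsum]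
    simp only [mul_add, add_mul, smul_mul_assoc, mul_smul_comm, hau, hbu, hua, hub, pa.idem,
      pb.idem, hab, hba, hα]
    module

/-- All complete systems of orthogonal primitive idempotents have three members: a system with `k`
members has an element with minimal polynomial of degree `k`, so `k ≤ 3`; and `k ≤ 2` would make
every element quadratic, contrary to the existence of `c`. -/
theorem card_frame_eq_three {β : LinearMap.BilinForm ℝ J} (hβ : IsEuclideanForm β)
    (hrank : jrank J = 3) {c : Fin 3 → J} (hc : IsJordanFrame c) {k : ℕ} {f : Fin k → J}
    (hf : IsJordanFrame f) : k = 3 := by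
  have h1 := hf.isIdempotentSystem.le_finrank_polySpan.trans (finrank_polySpan_le_jrank _)
  by_contra hne
  obtain ⟨p, q, h⟩ := exists_quadratic hβ (by omega) hf (∑ i : Fin 3, ((i : ℕ) : ℝ) • c i)
  have h2 := finrank_polySpan_le_two h
  have h3 := hc.isIdempotentSystem.le_finrank_polySpan
  omega

end Rank

/-! ### The trace form, and trace and determinant in ranks two and three -/

section TraceForm

variable {J : Type*} [NonAssocCommRing J] [Module ℝ J]

/-- The form `(x, y) = tr (x y)` of a Euclidean Jordan algebra of rank `r`: every element is
a combination of a complete system of `r` primitive idempotents, and these have trace one. -/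
structure IsTraceForm (r : ℕ) (τ : LinearMap.BilinForm ℝ J) : Prop extends IsEuclideanForm τ where
  exists_spectrum : ∀ x : J, ∃ lam, IsSpectrum r x lam
  apply_one : ∀ f : Fin r → J, IsJordanFrame f → ∀ i, τ (f i) 1 = 1

theorem IsEuclideanForm.smul {β : LinearMap.BilinForm ℝ J} (hβ : IsEuclideanForm β) {s : ℝ}
    (hs : 0 < s) : IsEuclideanForm (s • β) where
  symm x y := by simp [hβ.symm x y]
  pos x hx := mul_pos hs (hβ.pos x hx)
  assoc x y z := by simp [hβ.assoc x y z]

theorem IsTraceForm.apply_one_sum {r : ℕ} {τ : LinearMap.BilinForm ℝ J}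
    (hτ : IsTraceForm r τ) {f : Fin r → J} (hf : IsJordanFrame f) (lam : Fin r → ℝ) :
    τ (∑ i, lam i • f i) 1 = ∑ i, lam i := by
  rw [map_sum, LinearMap.sum_apply]
  refine Finset.sum_congr rfl fun i _ => ?_
  rw [map_smul, LinearMap.smul_apply, hτ.apply_one f hf, smul_eq_mul, mul_one]

theorem eigenvalues_spec {r : ℕ} {x : J} (h : ∃ lam, IsSpectrum r x lam) :
    IsSpectrum r x (eigenvalues r x) := by
  rw [eigenvalues, dif_pos h]
  exact h.choose_spec

namespace IsTraceForm

variable {r : ℕ} {τ : LinearMap.BilinForm ℝ J} (hτ : IsTraceForm r τ)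
include hτ

theorem jtrace_eq (x : J) : jtrace r x = τ x 1 := by
  obtain ⟨f, hf, hx⟩ := eigenvalues_spec (hτ.exists_spectrum x)
  conv_rhs => rw [hx]
  rw [hτ.apply_one_sum hf]
  rfl

theorem jtrace_mul (x y : J) : jtrace r (x * y) = τ x y := by
  rw [hτ.jtrace_eq, hτ.mul_one_right]

theorem sum_eigenvalues (x : J) : ∑ i, eigenvalues r x i = τ x 1 := hτ.jtrace_eq x

variable [SMulCommClass ℝ J J] [IsScalarTower ℝ J J]

theorem sum_eigenvalues_sq (x : J) : ∑ i, eigenvalues r x i ^ 2 = τ x x := by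
  obtain ⟨f, hf, hx⟩ := eigenvalues_spec (hτ.exists_spectrum x)
  rw [← hτ.mul_one_right]
  conv_rhs => rw [hx]
  rw [hf.isIdempotentSystem.sum_mul_sum, hτ.apply_one_sum hf]
  simp only [sq]

theorem sum_eigenvalues_cube (x : J) : ∑ i, eigenvalues r x i ^ 3 = τ x (x * x) := by
  obtain ⟨f, hf, hx⟩ := eigenvalues_spec (hτ.exists_spectrum x)
  rw [← hτ.mul_one_right]
  conv_rhs => rw [hx]
  rw [hf.isIdempotentSystem.sum_mul_sum, hf.isIdempotentSystem.sum_mul_sum, hτ.apply_one_sum hf]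
  exact Finset.sum_congr rfl fun i _ => by ring

/-- The eigenvalues of `x⁻¹` are the inverses of those of `x`. -/
theorem jtrace_jinv {x : J} (hx : ∀ i, eigenvalues r x i ≠ 0) :
    jtrace r (jinv x) = ∑ i, (eigenvalues r x i)⁻¹ := by
  classical
  obtain ⟨f, hf, hxf⟩ := eigenvalues_spec (hτ.exists_spectrum x)
  have hfs := hf.isIdempotentSystem
  set lam := eigenvalues r x
  have hspan : ∀ y ∈ polySpan x, ∃ mu : Fin r → ℝ, y = ∑ i, mu i • f i := by
    intro y hy
    induction hy using Submodule.span_induction with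
    | mem y hy =>
      obtain ⟨n, rfl⟩ := hy
      exact ⟨fun i => lam i ^ n, by rw [hxf, hfs.jpow_sum]⟩
    | zero => exact ⟨0, by simp⟩
    | add y z _ _ hy hz =>
      obtain ⟨m, rfl⟩ := hy
      obtain ⟨m', rfl⟩ := hz
      exact ⟨m + m', by simp [add_smul, Finset.sum_add_distrib]⟩
    | smul s y _ hy =>
      obtain ⟨m, rfl⟩ := hy
      exact ⟨fun i => s * m i, by simp [Finset.smul_sum, mul_smul]⟩
  have huniq : ∀ y ∈ polySpan x, x * y = 1 → y = ∑ i, (lam i)⁻¹ • f i := by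
    intro y hy h
    obtain ⟨m, rfl⟩ := hspan y hy
    rw [hxf, hfs.sum_mul_sum] at h
    refine Finset.sum_congr rfl fun i _ => ?_
    have h2 : f i * ∑ j, (lam j * m j) • f j = f i * 1 := by rw [h]
    rw [hfs.mul_sum, mul_one] at h2
    have h3 : lam i * m i = 1 :=
      smul_left_injective ℝ (hfs.ne_zero i) (by simpa using h2)
    rw [eq_inv_of_mul_eq_one_right h3]
  have hex : ∃ y ∈ polySpan x, x * y = 1 := by
    refine ⟨polyEval x (Lagrange.interpolate (Finset.univ.image lam) id (fun t => t⁻¹)),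
      polyEval_mem_polySpan _ _, ?_⟩
    conv_lhs => rw [hxf]
    rw [hfs.polyEval_sum, hfs.sum_mul_sum, ← hfs.complete]
    refine Finset.sum_congr rfl fun i _ => ?_
    have := Lagrange.eval_interpolate_at_node (s := Finset.univ.image lam) (v := id)
      (fun t : ℝ => t⁻¹) (Set.injOn_id _) (Finset.mem_image_of_mem lam (Finset.mem_univ i))
    rw [id] at this
    rw [this, mul_inv_cancel₀ (hx i), one_smul]
  have hinv : jinv x = ∑ i, (lam i)⁻¹ • f i := by
    rw [jinv, dif_pos hex]
    exact huniq _ hex.choose_spec.1 hex.choose_spec.2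
  rw [hinv, hτ.jtrace_eq, hτ.apply_one_sum hf]

end IsTraceForm

/-- Positivity of both eigenvalues, expressed by their sum and product. -/
theorem IsTraceForm.mem_cone_two {τ : LinearMap.BilinForm ℝ J}
    (hτ : IsTraceForm 2 τ) (x : J) : x ∈ cone J 2 ↔ 0 < τ x 1 ∧ 0 < jdet 2 x := by
  rw [jdet, ← hτ.sum_eigenvalues]
  simp only [cone, Set.mem_ofPred_eq, Fin.forall_fin_two, Fin.sum_univ_two, Fin.prod_univ_two]
  constructor
  · rintro ⟨h1, h2⟩
    exact ⟨by positivity, by positivity⟩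
  · rintro ⟨h1, h2⟩
    rcases mul_pos_iff.mp h2 with h | h
    · exact h
    · linarith [h.1, h.2]

section RankTwo

variable [SMulCommClass ℝ J J] [IsScalarTower ℝ J J]

variable {τ : LinearMap.BilinForm ℝ J} (hτ : IsTraceForm 2 τ)
include hτ

/-- Newton's identity for the product of two numbers. -/
theorem IsTraceForm.jdet_two (x : J) : jdet 2 x = (τ x 1 ^ 2 - τ x x) / 2 := by
  rw [jdet, ← hτ.sum_eigenvalues, ← hτ.sum_eigenvalues_sq]
  simp only [Fin.sum_univ_two, Fin.prod_univ_two]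
  ring

theorem IsTraceForm.jtrace_jinv_two {x : J} (hx : x ∈ cone J 2) :
    jtrace 2 (jinv x) = τ x 1 / jdet 2 x := by
  have h0 := hx 0
  have h1 := hx 1
  rw [hτ.jtrace_jinv fun i => (hx i).ne', jdet, ← hτ.sum_eigenvalues]
  simp only [Fin.sum_univ_two, Fin.prod_univ_two]
  field_simp
  ring

theorem IsTraceForm.cube_two (x : J) : 2 * τ x (x * x) = 3 * τ x 1 * τ x x - τ x 1 ^ 3 := by
  rw [← hτ.sum_eigenvalues, ← hτ.sum_eigenvalues_sq, ← hτ.sum_eigenvalues_cube]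
  simp only [Fin.sum_univ_two]
  ring

/-- The Cayley-Hamilton identity in rank two. -/
theorem IsTraceForm.mul_self_two (x : J) : x * x = τ x 1 • x - jdet 2 x • (1 : J) := by
  obtain ⟨f, hf, hx⟩ := eigenvalues_spec (hτ.exists_spectrum x)
  rw [jdet, ← hτ.sum_eigenvalues]
  set lam := eigenvalues 2 x
  rw [hx, hf.isIdempotentSystem.sum_mul_sum, ← hf.complete]
  simp only [Fin.sum_univ_two, Fin.prod_univ_two]
  module

end RankTwo

section RankThree

variable [SMulCommClass ℝ J J] [IsScalarTower ℝ J J]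

variable {τ : LinearMap.BilinForm ℝ J} (hτ : IsTraceForm 3 τ)
include hτ

/-- Newton's identity for the product of three numbers. -/
theorem IsTraceForm.jdet_three (x : J) :
    jdet 3 x = (τ x 1 ^ 3 - 3 * τ x 1 * τ x x + 2 * τ x (x * x)) / 6 := by
  rw [jdet, ← hτ.sum_eigenvalues, ← hτ.sum_eigenvalues_sq, ← hτ.sum_eigenvalues_cube]
  simp only [Fin.sum_univ_three, Fin.prod_univ_three]
  ring

/-- Positivity of the eigenvalues, expressed by their elementary symmetric functions. Unlike the
eigenvalues themselves, these are polynomials in the coordinates of `x`. -/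
theorem IsTraceForm.mem_cone_three (x : J) :
    x ∈ cone J 3 ↔ 0 < τ x 1 ∧ 0 < τ x 1 ^ 2 - τ x x ∧ 0 < jdet 3 x := by
  rw [jdet, ← hτ.sum_eigenvalues, ← hτ.sum_eigenvalues_sq]
  simp only [cone, Set.mem_ofPred_eq, Fin.forall_fin_succ, Fin.sum_univ_three, Fin.prod_univ_three,
    IsEmpty.forall_iff, and_true, Fin.succ_zero_eq_one, Fin.succ_one_eq_two]
  set a := eigenvalues 3 x 0
  set b := eigenvalues 3 x 1
  set c := eigenvalues 3 x 2
  rw [show (a + b + c) ^ 2 - (a ^ 2 + b ^ 2 + c ^ 2) = 2 * (a * b + b * c + a * c) by ring]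
  constructor
  · rintro ⟨h1, h2, h3⟩
    exact ⟨by positivity, by positivity, by positivity⟩
  · rintro ⟨h1, h2, h3⟩
    -- a nonpositive root of the characteristic polynomial would give it a value `≤ -abc < 0`
    have key : ∀ s, s ^ 3 - (a + b + c) * s ^ 2 + (a * b + b * c + a * c) * s - a * b * c = 0 →
        0 < s := by
      intro s hs
      by_contra! hneg
      have e1 : s ^ 3 ≤ 0 := by
        have := mul_nonneg (sq_nonneg s) (neg_nonneg.mpr hneg)
        nlinarith
      have e2 : 0 ≤ (a + b + c) * s ^ 2 := by positivity
      have e3 : (a * b + b * c + a * c) * s ≤ 0 :=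
        mul_nonpos_of_nonneg_of_nonpos (by linarith) hneg
      linarith
    exact ⟨key a (by ring), key b (by ring), key c (by ring)⟩

theorem IsTraceForm.jtrace_jinv_three {x : J} (hx : x ∈ cone J 3) :
    jtrace 3 (jinv x) = (τ x 1 ^ 2 - τ x x) / 2 / jdet 3 x := by
  have h0 := hx 0
  have h1 := hx 1
  have h2 := hx 2
  rw [hτ.jtrace_jinv fun i => (hx i).ne', jdet, ← hτ.sum_eigenvalues, ← hτ.sum_eigenvalues_sq]
  simp only [Fin.sum_univ_three, Fin.prod_univ_three]
  field_simp
  ring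

end RankThree

variable [SMulCommClass ℝ J J] [IsScalarTower ℝ J J] [FiniteDimensional ℝ J] [IsCommJordan J]

/-- The trace form of a simple algebra of rank three is a multiple of any Euclidean form, since such
a form takes the same value on all members of a complete system, namely `β(1, 1) / 3`. -/
theorem exists_isTraceForm_three [IsSimpleRing J] (hJ : IsEuclidean J) (hrank : jrank J = 3)
    {c : Fin 3 → J} (hc : IsJordanFrame c) :
    ∃ τ : LinearMap.BilinForm ℝ J, IsTraceForm 3 τ := by
  obtain ⟨β, h1, h2, h3⟩ := hJ
  have hβ : IsEuclideanForm β := ⟨h1, h2, h3⟩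
  have hone : (1 : J) ≠ 0 := fun h =>
    (hc.primitive 0).ne_zero (by rw [← one_mul (c 0), h, zero_mul])
  have hpos := hβ.pos 1 hone
  refine ⟨(3 / β 1 1) • β, ⟨hβ.smul (by positivity), fun x => ?_, fun f hf i => ?_⟩⟩
  · obtain ⟨k, f, lam, hf, hx⟩ := exists_jordanFrame hβ x
    obtain rfl := card_frame_eq_three hβ hrank hc hf
    exact ⟨lam, f, hf, hx⟩
  · have key : β (f i) 1 = β 1 1 / 3 := by
      have ht := hf.isTriple
      fin_cases i
      · exact ht.form_eq_third hβ hβ.assoc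
      · exact ht.swap₁₂.form_eq_third hβ hβ.assoc
      · exact ht.swap₂₃.swap₁₂.form_eq_third hβ hβ.assoc
    simp only [LinearMap.smul_apply, smul_eq_mul, key]
    field_simp

/-- The trace form of `A` restricts to that of `A_0(c₃)`, because a complete system of `A_0(c₃)`
together with `c₃` is one of `A`. -/
theorem IsTraceForm.peirceZero {τ : LinearMap.BilinForm ℝ J} (hτ : IsTraceForm 3 τ)
    (hrank : jrank J = 3) {c : Fin 3 → J} (hc : IsJordanFrame c) :
    IsTraceForm 2 (restrictForm τ (c 2) (hc.primitive 2).idem) where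
  toIsEuclideanForm := hτ.toIsEuclideanForm.restrictForm _ _
  exists_spectrum x := by
    obtain ⟨k, f, lam, hf, hx⟩ := exists_jordanFrame (hτ.toIsEuclideanForm.restrictForm _ _) x
    have := card_frame_eq_three hτ.toIsEuclideanForm hrank hc
      (IsJordanFrame.snoc hτ.toIsEuclideanForm (hc.primitive 2) hf)
    obtain rfl : k = 2 := by omega
    exact ⟨lam, f, hf, hx⟩
  apply_one f hf i := by
    have h := hτ.apply_one _ (IsJordanFrame.snoc hτ.toIsEuclideanForm (hc.primitive 2) hf)
      i.castSucc
    rw [Fin.snoc_castSucc] at h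
    change τ (f i) (1 - c 2) = 1
    rw [map_sub, h, ← hτ.mul_one_right, mul_comm, mul_eq_zero_of_peirceZero_mem (f i)]
    simp

end TraceForm

/-! ### The representation of `A_0(c)` on `A_½(c)` -/

section PeirceHalf

variable {J : Type*} [NonAssocCommRing J] [Module ℝ J] [SMulCommClass ℝ J J]

/-- The Peirce space `A_½(c)`. -/
def peirceHalf (c : J) : Submodule ℝ J where
  carrier := {v | c * v = (1 / 2 : ℝ) • v}
  zero_mem' := by simp
  add_mem' := by
    intro v w (hv : c * v = _) (hw : c * w = _)
    change c * (v + w) = _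
    rw [mul_add, hv, hw, smul_add]
  smul_mem' := by
    intro t v (hv : c * v = _)
    change c * (t • v) = _
    rw [mul_smul_comm, hv, smul_comm]

theorem mul_coe_peirceHalf {c : J} (v : peirceHalf c) : c * (v : J) = (1 / 2 : ℝ) • (v : J) := v.2

variable [IsScalarTower ℝ J J] [IsCommJordan J]

/-- The representation `y ↦ 2 L(y)` of the Jordan algebra `A_0(c)` on `A_½(c)`. -/
def peirceRep (c : J) (hc : c * c = c) : peirceZero c hc →ₗ[ℝ] Module.End ℝ (peirceHalf c) where
  toFun y :=
    { toFun := fun v => ⟨(2 : ℝ) • ((y : J) * v), (peirceHalf c).smul_mem _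
        (peirceZero_mul_peirceHalf hc y.2 v.2)⟩
      map_add' := fun v w => Subtype.ext (by
        change (2 : ℝ) • ((y : J) * (v + w)) = (2 : ℝ) • ((y : J) * v) + (2 : ℝ) • ((y : J) * w)
        rw [mul_add, smul_add])
      map_smul' := fun t v => Subtype.ext (by
        change (2 : ℝ) • ((y : J) * (t • (v : J))) = t • (2 : ℝ) • ((y : J) * v)
        rw [mul_smul_comm, smul_comm]) }
  map_add' y z := LinearMap.ext fun v => Subtype.ext (by
    change (2 : ℝ) • (((y : J) + z) * v) = (2 : ℝ) • ((y : J) * v) + (2 : ℝ) • ((z : J) * v)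
    rw [add_mul, smul_add])
  map_smul' t y := LinearMap.ext fun v => Subtype.ext (by
    change (2 : ℝ) • ((t • (y : J)) * v) = t • (2 : ℝ) • ((y : J) * v)
    rw [smul_mul_assoc, smul_comm])

theorem coe_peirceRep_apply {c : J} (hc : c * c = c) (y : peirceZero c hc) (v : peirceHalf c) :
    (peirceRep c hc y v : J) = (2 : ℝ) • ((y : J) * v) := rfl

theorem peirceRep_one {c : J} (hc : c * c = c) : peirceRep c hc 1 = 1 :=
  LinearMap.ext fun v => Subtype.ext (by
    rw [coe_peirceRep_apply, coe_one_peirceZero, sub_mul, one_mul, mul_coe_peirceHalf]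
    change (2 : ℝ) • ((v : J) - (1 / 2 : ℝ) • (v : J)) = v
    module)

theorem two_smul_peirceRep_mul {c : J} (hc : c * c = c) (y z : peirceZero c hc) :
    (2 : ℝ) • peirceRep c hc (y * z) =
      peirceRep c hc y * peirceRep c hc z + peirceRep c hc z * peirceRep c hc y :=
  LinearMap.ext fun v => Subtype.ext (by
    change (2 : ℝ) • (2 : ℝ) • (((y : J) * z) * v) =
      (2 : ℝ) • ((y : J) * ((2 : ℝ) • ((z : J) * v))) +
        (2 : ℝ) • ((z : J) * ((2 : ℝ) • ((y : J) * v)))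
    rw [mul_mul_of_peirceHalf hc y.2 z.2 v.2, mul_smul_comm, mul_smul_comm]
    module)

theorem peirceRep_mul_self {c : J} (hc : c * c = c) (y : peirceZero c hc) :
    peirceRep c hc (y * y) = peirceRep c hc y * peirceRep c hc y := by
  have h := two_smul_peirceRep_mul hc y y
  rw [← two_smul ℝ (_ * _)] at h
  exact smul_right_injective _ (two_ne_zero : (2 : ℝ) ≠ 0) h

end PeirceHalf

/-! ### Dimensions of the Peirce spaces -/

section Dimension

variable {J : Type*} [NonAssocCommRing J] [Module ℝ J] [SMulCommClass ℝ J J]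
  [IsScalarTower ℝ J J]

/-- The trace form `tr L(x y)` of the regular representation. -/
noncomputable def regularForm (J : Type*) [NonAssocCommRing J] [Module ℝ J] [SMulCommClass ℝ J J]
    [IsScalarTower ℝ J J] : LinearMap.BilinForm ℝ J :=
  LinearMap.mk₂ ℝ (fun x y => LinearMap.trace ℝ J (LinearMap.mulLeft ℝ (x * y)))
    (fun x x' y => by rw [← map_add]; congr 1; ext z; simp [add_mul])
    (fun s x y => by rw [← map_smul]; congr 1; ext z; simp [smul_mul_assoc])
    (fun x y y' => by rw [← map_add]; congr 1; ext z; simp [add_mul, mul_add])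
    (fun s x y => by rw [← map_smul]; congr 1; ext z; simp [smul_mul_assoc, mul_smul_comm])

theorem regularForm_apply (x y : J) :
    regularForm J x y = LinearMap.trace ℝ J (LinearMap.mulLeft ℝ (x * y)) := rfl

/-- The trace of the operator identity `mul_mul_mul_eq`. -/
theorem trace_mulLeft_mul_mul {J : Type*} [NonAssocCommRing J] [Module ℝ J] [SMulCommClass ℝ J J]
    [IsCommJordan J] (x y w : J) :
    LinearMap.trace ℝ J (LinearMap.mulLeft ℝ ((x * y) * w)) =
      LinearMap.trace ℝ J (LinearMap.mulLeft ℝ (y * w) * LinearMap.mulLeft ℝ x) +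
      LinearMap.trace ℝ J (LinearMap.mulLeft ℝ (x * y) * LinearMap.mulLeft ℝ w) +
      LinearMap.trace ℝ J (LinearMap.mulLeft ℝ (x * w) * LinearMap.mulLeft ℝ y) -
      LinearMap.trace ℝ J (LinearMap.mulLeft ℝ y * (LinearMap.mulLeft ℝ w * LinearMap.mulLeft ℝ x))
      - LinearMap.trace ℝ J
        (LinearMap.mulLeft ℝ x * (LinearMap.mulLeft ℝ w * LinearMap.mulLeft ℝ y)) := by
  rw [← map_add, ← map_add, ← map_sub, ← map_sub]
  congr 1
  ext z
  exact mul_mul_mul_eq x y w z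

variable [IsCommJordan J]

/-- The form `tr L(x y)` is associative: in `trace_mulLeft_mul_mul` the cubic terms cancel by
cyclicity of the trace. -/
theorem regularForm_assoc (x y z : J) : regularForm J (x * y) z = regularForm J y (x * z) := by
  rw [regularForm_apply, regularForm_apply, mul_comm y (x * z), mul_comm x z,
    trace_mulLeft_mul_mul, trace_mulLeft_mul_mul, mul_comm z x, mul_comm z y]
  have e1 := LinearMap.trace_mul_cycle' ℝ (LinearMap.mulLeft ℝ y)
    (LinearMap.mulLeft ℝ z) (LinearMap.mulLeft ℝ x)
  have e2 := LinearMap.trace_mul_cycle' ℝ (LinearMap.mulLeft ℝ z)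
    (LinearMap.mulLeft ℝ y) (LinearMap.mulLeft ℝ x)
  linarith

variable [FiniteDimensional ℝ J]

/-- `L(c)` has trace `1 + ½ dim A_½(c)`: it is the sum of the projection `2 L² - L` to `ℝ c` and
half the projection `4 (L - L²)` to `A_½(c)`. -/
theorem trace_mulLeft_idem {β : LinearMap.BilinForm ℝ J} (hβ : IsEuclideanForm β) {c : J}
    (hc : IsPrimitiveIdempotent c) :
    LinearMap.trace ℝ J (LinearMap.mulLeft ℝ c) =
      1 + (Module.finrank ℝ (peirceHalf c) : ℝ) / 2 := by
  set L := LinearMap.mulLeft ℝ c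
  have h1 : LinearMap.IsProj (Submodule.span ℝ {c}) ((2 : ℝ) • (L * L) - L) := by
    refine ⟨fun x => ?_, fun x hx => ?_⟩
    · obtain ⟨t, ht⟩ := exists_eq_smul_of_peirceOne hβ hc (idem_peirceOne_component hc.idem x)
      exact Submodule.mem_span_singleton.mpr ⟨t, ht.symm⟩
    · obtain ⟨t, rfl⟩ := Submodule.mem_span_singleton.mp hx
      change (2 : ℝ) • (c * (c * t • c)) - c * t • c = t • c
      rw [mul_smul_comm, hc.idem, mul_smul_comm, hc.idem]
      module
  have h2 : LinearMap.IsProj (peirceHalf c) ((4 : ℝ) • (L - L * L)) := by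
    refine ⟨fun x => ?_, fun x hx => ?_⟩
    · exact (peirceHalf c).smul_mem _ (idem_peirceHalf_component hc.idem x)
    · have hx' : c * x = (1 / 2 : ℝ) • x := hx
      change (4 : ℝ) • (c * x - c * (c * x)) = x
      rw [hx', mul_smul_comm, hx']
      module
  have e1 := h1.trace
  have e2 := h2.trace
  rw [finrank_span_singleton hc.ne_zero] at e1
  have : L = ((2 : ℝ) • (L * L) - L) + (1 / 2 : ℝ) • ((4 : ℝ) • (L - L * L)) := by module
  rw [this, map_add, map_smul, e1, e2]
  push_cast
  rw [smul_eq_mul]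
  ring

/-- In a simple Euclidean Jordan algebra of rank three and dimension `3 + 3 d`, the Peirce spaces
`A_½` of members of complete systems have dimension `2 d`: the form `tr L(x y)` is associative, so
each `L(c)` has one third of the trace of the identity, `1 + d`. -/
theorem IsTriple.finrank_peirceHalf [IsSimpleRing J] {β : LinearMap.BilinForm ℝ J}
    (hβ : IsEuclideanForm β) {a b c : J} (h : IsTriple a b c) {d : ℕ}
    (hd : Module.finrank ℝ J = 3 + 3 * d) : Module.finrank ℝ (peirceHalf a) = 2 * d := by
  have h1 := h.form_eq_third hβ regularForm_assoc
  rw [regularForm_apply, regularForm_apply, mul_one, mul_one, trace_mulLeft_idem hβ h.prim₁,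
    show LinearMap.mulLeft ℝ (1 : J) = 1 from LinearMap.ext one_mul, LinearMap.trace_one, hd] at h1
  push_cast at h1
  have : (Module.finrank ℝ (peirceHalf a) : ℝ) = 2 * d := by linarith
  exact_mod_cast this

/-- The Peirce decomposition `A = A_0(c) ⊕ A_½(c) ⊕ ℝ c` for a primitive idempotent `c`. -/
noncomputable def peirceEquiv {β : LinearMap.BilinForm ℝ J} (hβ : IsEuclideanForm β) {c : J}
    (hc : IsPrimitiveIdempotent c) : (peirceZero c hc.idem × peirceHalf c × ℝ) ≃ₗ[ℝ] J :=
  LinearEquiv.ofBijective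
    ((peirceZero c hc.idem).toSubmodule.subtype.coprod
      ((peirceHalf c).subtype.coprod (LinearMap.toSpanSingleton ℝ J c))) (by
    constructor
    · rw [injective_iff_map_eq_zero]
      rintro ⟨y, v, t⟩ h
      have h : (y : J) + ((v : J) + t • c) = 0 := h
      have h1 : c * ((y : J) + ((v : J) + t • c)) = 0 := by rw [h, mul_zero]
      rw [mul_add, mul_add, mul_eq_zero_of_peirceZero_mem y, mul_coe_peirceHalf, mul_smul_comm,
        hc.idem, zero_add] at h1
      have h2 : c * ((1 / 2 : ℝ) • (v : J) + t • c) = 0 := by rw [h1, mul_zero]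
      rw [mul_add, mul_smul_comm, mul_coe_peirceHalf, mul_smul_comm, hc.idem] at h2
      have hv : (v : J) = 0 := by
        rw [show (v : J) = (4 : ℝ) • (((1 / 2 : ℝ) • (v : J) + t • c) -
          ((1 / 2 : ℝ) • (1 / 2 : ℝ) • (v : J) + t • c)) by module, h1, h2]
        simp
      rw [hv, smul_zero, zero_add] at h1
      have ht : t = 0 := (smul_eq_zero.mp h1).resolve_right hc.ne_zero
      rw [hv, ht, zero_smul, add_zero, add_zero] at h
      exact Prod.ext (Subtype.ext h) (Prod.ext (Subtype.ext hv) ht)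
    · intro x
      obtain ⟨t, ht⟩ := exists_eq_smul_of_peirceOne hβ hc (idem_peirceOne_component hc.idem x)
      have hv : (4 : ℝ) • (c * x - c * (c * x)) ∈ peirceHalf c :=
        (peirceHalf c).smul_mem _ (idem_peirceHalf_component hc.idem x)
      have hy : c * (x - ((4 : ℝ) • (c * x - c * (c * x)) + t • c)) = 0 := by
        rw [mul_sub, mul_add, mul_smul_comm, idem_peirceHalf_component hc.idem, ← ht,
          idem_peirceOne_component hc.idem]
        module
      refine ⟨⟨⟨_, hy⟩, ⟨_, hv⟩, t⟩, ?_⟩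
      change x - ((4 : ℝ) • (c * x - c * (c * x)) + t • c) +
        ((4 : ℝ) • (c * x - c * (c * x)) + t • c) = x
      abel)

theorem peirceEquiv_apply {β : LinearMap.BilinForm ℝ J} (hβ : IsEuclideanForm β) {c : J}
    (hc : IsPrimitiveIdempotent c) (y : peirceZero c hc.idem) (v : peirceHalf c) (t : ℝ) :
    peirceEquiv hβ hc (y, v, t) = (y : J) + ((v : J) + t • c) := rfl

theorem finrank_peirce {β : LinearMap.BilinForm ℝ J} (hβ : IsEuclideanForm β) {c : J}
    (hc : IsPrimitiveIdempotent c) : Module.finrank ℝ J =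
      Module.finrank ℝ (peirceZero c hc.idem) + (Module.finrank ℝ (peirceHalf c) + 1) := by
  rw [← (peirceEquiv hβ hc).finrank_eq, Module.finrank_prod, Module.finrank_prod,
    Module.finrank_self]

end Dimension

/-! ### The trace form in the Peirce decomposition -/

section PeirceOrthogonality

variable {J : Type*} [NonAssocCommRing J] [Module ℝ J] {τ : LinearMap.BilinForm ℝ J}
  (hτ : IsEuclideanForm τ) {c : J}
include hτ

theorem IsEuclideanForm.zero_half {y v : J} (hy : c * y = 0) (hv : c * v = (1 / 2 : ℝ) • v) :
    τ y v = 0 := by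
  have h := hτ.assoc c y v
  rw [hy, hv] at h
  simpa using h

theorem IsEuclideanForm.zero_idem {y : J} (hc : c * c = c) (hy : c * y = 0) : τ y c = 0 := by
  have h := hτ.assoc c y c
  rw [hy, hc] at h
  simpa using h.symm

theorem IsEuclideanForm.half_idem {v : J} (hc : c * c = c) (hv : c * v = (1 / 2 : ℝ) • v) :
    τ v c = 0 := by
  have h := hτ.assoc c v c
  rw [hv, hc] at h
  simp only [map_smul, LinearMap.smul_apply, smul_eq_mul] at h
  linarith

/-- The Peirce spaces are orthogonal. -/
theorem IsEuclideanForm.peirce_sq {y v : J} (hc : c * c = c) (hcc : τ c c = 1) (hy : c * y = 0)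
    (hv : c * v = (1 / 2 : ℝ) • v) (t : ℝ) :
    τ (y + (v + t • c)) (y + (v + t • c)) = τ y y + τ v v + t ^ 2 := by
  have e1 := hτ.zero_half hy hv
  have e2 := hτ.zero_idem hc hy
  have e3 := hτ.half_idem hc hv
  simp only [map_add, map_smul, LinearMap.add_apply, LinearMap.smul_apply, smul_eq_mul, e1, e2, e3,
    hτ.symm v y, hτ.symm c y, hτ.symm c v, hcc]
  ring

variable [SMulCommClass ℝ J J] [IsScalarTower ℝ J J] [IsCommJordan J]

theorem IsEuclideanForm.half_cube {v : J} (hc : c * c = c) (hv : c * v = (1 / 2 : ℝ) • v) :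
    τ v (v * v) = 0 := by
  have h := peirceHalf_sq hc hv
  have h1 : τ v (c * (c * (v * v))) = (1 / 2) * τ v (c * (v * v)) := by
    rw [← hτ.assoc, hv]; simp
  have h2 : τ v (c * (v * v)) = (1 / 2) * τ v (v * v) := by
    rw [← hτ.assoc, hv]; simp
  rw [h] at h1
  linarith

theorem IsEuclideanForm.peirce_cube {y v : J} (hc : c * c = c) (hcc : τ c c = 1) (hy : c * y = 0)
    (hv : c * v = (1 / 2 : ℝ) • v) (t : ℝ) :
    τ (y + (v + t • c)) ((y + (v + t • c)) * (y + (v + t • c))) =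
      τ y (y * y) + 3 * τ v (y * v) + 3 / 2 * t * τ v v + t ^ 3 := by
  have e1 := hτ.zero_half hy hv
  have e2 := hτ.zero_idem hc hy
  have e3 := hτ.half_idem hc hv
  have e4 := hτ.half_cube hc hv
  have hyy := mul_mul_eq_zero_of_peirce hc hy hy
  have hyv := peirceZero_mul_peirceHalf hc hy hv
  have f1 : τ v (y * y) = 0 := by rw [hτ.symm]; exact hτ.zero_half hyy hv
  have f2 : τ c (y * y) = 0 := by rw [hτ.symm]; exact hτ.zero_idem hc hyy
  have f3 : τ y (y * v) = 0 := hτ.zero_half hy hyv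
  have f4 : τ c (y * v) = 0 := by rw [hτ.symm]; exact hτ.half_idem hc hyv
  have f5 : τ y (v * v) = τ v (y * v) := by rw [hτ.symm, hτ.assoc, mul_comm]
  have f6 : τ c (v * v) = 1 / 2 * τ v v := by
    rw [hτ.symm, hτ.assoc, mul_comm, hv]; simp
  have hsq : (y + (v + t • c)) * (y + (v + t • c)) =
      y * y + v * v + (t * t) • c + (2 : ℝ) • (y * v) + t • v := by
    simp only [mul_add, add_mul, smul_mul_assoc, mul_smul_comm, hy, hv, hc, mul_comm y c,
      mul_comm v c, mul_comm v y]
    module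
  rw [hsq]
  simp only [map_add, map_smul, LinearMap.add_apply, LinearMap.smul_apply, smul_eq_mul, e1, e2, e3,
    e4, f1, f2, f3, f4, f5, f6, hτ.symm c v, hcc]
  ring

end PeirceOrthogonality

/-! ### Peirce coordinates on the cone -/

section PeirceCoordinates

variable {J : Type*} [NonAssocCommRing J] [Module ℝ J] [SMulCommClass ℝ J J]
  [IsCommJordan J] {τ : LinearMap.BilinForm ℝ J}

/-- A point of the cone has positive inner product with every nonzero idempotent. -/
theorem IsTraceForm.idem_pos {J : Type*} [NonAssocCommRing J] [Module ℝ J] [IsCommJordan J]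
    {τ : LinearMap.BilinForm ℝ J} {r : ℕ} (hτ : IsTraceForm r τ) {x g : J} (hx : x ∈ cone J r)
    (hg : g * g = g) (hg0 : g ≠ 0) : 0 < τ x g := by
  obtain ⟨f, hf, hxf⟩ := eigenvalues_spec (hτ.exists_spectrum x)
  have hnn : ∀ i, 0 ≤ τ (f i) g := fun i => hτ.idem_idem_nonneg (hf.primitive i).idem hg
  have h1 : 0 < ∑ i, τ (f i) g := by
    rw [← LinearMap.sum_apply, ← map_sum, hf.complete, hτ.symm, ← hτ.mul_one_right, mul_one,
      ← hg, hτ.mul_one_right]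
    exact hτ.pos g hg0
  have h2 : τ x g = ∑ i, eigenvalues r x i * τ (f i) g := by
    conv_lhs => rw [hxf]
    simp
  rw [h2]
  obtain ⟨i, hi, hpos⟩ := Finset.exists_lt_of_sum_lt (f := fun _ : Fin r => (0 : ℝ))
    (g := fun i => τ (f i) g) (s := Finset.univ) (by simpa using h1)
  exact Finset.sum_pos' (fun i _ => mul_nonneg (hx i).le (hnn i)) ⟨i, hi, mul_pos (hx i) hpos⟩

theorem restrictForm_apply_one (hτ : IsEuclideanForm τ) {c : J} (hc : c * c = c)
    (y : peirceZero c hc) :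
    restrictForm τ c hc y 1 = τ (y : J) 1 := by
  change τ (y : J) (1 - c) = _
  rw [map_sub, hτ.zero_idem hc (mul_eq_zero_of_peirceZero_mem y), sub_zero]

/-- The `A_0(c)`-component of a point of the cone lies in the cone of `A_0(c)`: its eigenvalues are
inner products of the point with idempotents. -/
theorem mem_cone_two_of_mem_cone_three (hτ : IsTraceForm 3 τ) {c : J}
    (hc : IsPrimitiveIdempotent c) (hτ₀ : IsTraceForm 2 (restrictForm τ c hc.idem))
    (y : peirceZero c hc.idem) (v : peirceHalf c) (t : ℝ)
    (h : (y : J) + ((v : J) + t • c) ∈ cone J 3) :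
    y ∈ cone (peirceZero c hc.idem) 2 := by
  intro i
  obtain ⟨g, hg, hyg⟩ := eigenvalues_spec (hτ₀.exists_spectrum y)
  have e1 : eigenvalues 2 y i = τ (y : J) (g i) := by
    have : restrictForm τ c hc.idem (g i * y) 1 = eigenvalues 2 y i := by
      conv_lhs => rw [hyg]
      rw [hg.isIdempotentSystem.mul_sum, map_smul, LinearMap.smul_apply, hτ₀.apply_one g hg,
        smul_eq_mul, mul_one]
    rw [← this, hτ₀.mul_one_right, hτ₀.symm]
    rfl
  have hgi : (g i : J) * g i = g i := congrArg Subtype.val (hg.primitive i).idem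
  have hg0 : (g i : J) ≠ 0 := fun h0 => (hg.primitive i).ne_zero (Subtype.ext h0)
  have e2 : τ ((y : J) + ((v : J) + t • c)) (g i) = τ (y : J) (g i) := by
    simp only [map_add, map_smul, LinearMap.add_apply, LinearMap.smul_apply, smul_eq_mul]
    rw [hτ.symm (v : J), hτ.zero_half (g i).2 v.2, hτ.symm c, hτ.zero_idem hc.idem (g i).2]
    ring
  rw [e1, ← e2]
  exact hτ.idem_pos h hgi hg0

variable [IsScalarTower ℝ J J] (hτ : IsEuclideanForm τ) {c : J}
  (hc : IsPrimitiveIdempotent c) (hcc : τ c c = 1) (hτ₀ : IsTraceForm 2 (restrictForm τ c hc.idem))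

/-- The point `y + Φ(y) w + (s + ½ (w, Φ(y) w)) c` of `A`, where `Φ(y) = 2 L(y)`. In these
coordinates `det = s det y`. -/
def peircePoint (τ : LinearMap.BilinForm ℝ J) {c : J} {hc : c * c = c} (y : peirceZero c hc)
    (w : peirceHalf c) (s : ℝ) : J :=
  (y : J) + ((peirceRep c hc y w : J) + (s + τ (w : J) ((y : J) * w)) • c)

include hτ₀ in
/-- The operator `Φ(y) = 2 L(y)` on `A_½(c)` satisfies the characteristic equation of `y`. -/
theorem mul_mul_of_cayleyHamilton (y : peirceZero c hc.idem) (w : peirceHalf c) :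
    (y : J) * ((y : J) * w) = (restrictForm τ c hc.idem y 1 / 2) • ((y : J) * w) -
      (jdet 2 y / 4) • (w : J) := by
  have h := mul_mul_of_peirceHalf hc.idem y.2 y.2 w.2
  have h2 : (y : J) * y = restrictForm τ c hc.idem y 1 • (y : J) - jdet 2 y • (1 - c) :=
    congrArg Subtype.val (hτ₀.mul_self_two y)
  rw [h2, sub_mul, smul_mul_assoc, smul_mul_assoc, sub_mul, one_mul, mul_coe_peirceHalf] at h
  apply eq_of_two_smul_eq
  rw [two_smul, ← h]
  module

include hτ hτ₀ in
theorem form_mul_mul (y : peirceZero c hc.idem) (w : peirceHalf c) :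
    τ ((y : J) * w) ((y : J) * w) =
      restrictForm τ c hc.idem y 1 / 2 * τ (w : J) ((y : J) * w) -
        jdet 2 y / 4 * τ (w : J) w := by
  rw [hτ.assoc, mul_mul_of_cayleyHamilton hc hτ₀]
  simp

include hτ in
theorem one_peircePoint (hcc : τ c c = 1) (y : peirceZero c hc.idem) (w : peirceHalf c) (s : ℝ) :
    τ (peircePoint τ y w s) 1 =
      restrictForm τ c hc.idem y 1 + (s + τ (w : J) ((y : J) * w)) := by
  have h1 : τ (peirceRep c hc.idem y w : J) 1 = 0 := by
    have e1 := hτ.half_idem hc.idem (peirceRep c hc.idem y w).2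
    rw [← hτ.mul_one_right, mul_comm, mul_coe_peirceHalf] at e1
    simpa using e1
  have h2 : τ c 1 = 1 := by rw [← hc.idem, hτ.mul_one_right, hcc]
  rw [peircePoint, restrictForm_apply_one hτ hc.idem]
  simp only [map_add, map_smul, LinearMap.add_apply, LinearMap.smul_apply, smul_eq_mul, h1, h2]
  ring

include hτ hcc hτ₀ in
/-- The second elementary symmetric function of the eigenvalues of `peircePoint τ y w s`. -/
theorem sq_peircePoint (y : peirceZero c hc.idem) (w : peirceHalf c) (s : ℝ) :
    (τ (peircePoint τ y w s) 1 ^ 2 - τ (peircePoint τ y w s) (peircePoint τ y w s)) / 2 =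
      jdet 2 y + restrictForm τ c hc.idem y 1 * s + jdet 2 y * τ (w : J) w / 2 := by
  rw [one_peircePoint hτ hc hcc]
  simp only [peircePoint]
  rw [hτ.peirce_sq hc.idem hcc y.2 (peirceRep c hc.idem y w).2, coe_peirceRep_apply]
  have h1 := form_mul_mul hτ hc hτ₀ y w
  have h2 := hτ₀.jdet_two y
  have h3 : restrictForm τ c hc.idem y y = τ (y : J) y := rfl
  rw [h3] at h2
  have h4 : τ (y : J) y = restrictForm τ c hc.idem y 1 ^ 2 - 2 * jdet 2 y := by linarith
  simp only [map_smul, LinearMap.smul_apply, smul_eq_mul, h1, h4]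
  ring

include hc hcc hτ₀ in
/-- The `c`-component of `peircePoint` is chosen such that the contribution of `w` to the
determinant cancels. -/
theorem jdet_peircePoint (hτ : IsTraceForm 3 τ) (y : peirceZero c hc.idem) (w : peirceHalf c)
    (s : ℝ) : jdet 3 (peircePoint τ y w s) = s * jdet 2 y := by
  have hτ' := hτ.toIsEuclideanForm
  rw [hτ.jdet_three, one_peircePoint hτ' hc hcc]
  simp only [peircePoint]
  rw [hτ.peirce_sq hc.idem hcc y.2 (peirceRep c hc.idem y w).2,
    hτ.peirce_cube hc.idem hcc y.2 (peirceRep c hc.idem y w).2, coe_peirceRep_apply]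
  have h1 := form_mul_mul hτ' hc hτ₀ y w
  have h2 := hτ₀.jdet_two y
  have h3 : restrictForm τ c hc.idem y y = τ (y : J) y := rfl
  have h5 : 2 * τ (y : J) (y * y) = 3 * restrictForm τ c hc.idem y 1 * τ (y : J) y -
    restrictForm τ c hc.idem y 1 ^ 3 := hτ₀.cube_two y
  rw [h3] at h2
  have h4 : τ (y : J) y = restrictForm τ c hc.idem y 1 ^ 2 - 2 * jdet 2 y := by linarith
  have h6 : τ ((y : J) * w) w = τ (w : J) ((y : J) * w) := hτ.symm _ _
  simp only [map_smul, LinearMap.smul_apply, smul_eq_mul, mul_smul_comm,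
    mul_mul_of_cayleyHamilton hc hτ₀, map_sub, h6, h1]
  rw [h4] at h5 ⊢
  linear_combination (1 / 6 : ℝ) * h5

include hc hcc hτ₀ in
/-- In Peirce coordinates, `Ω₃` is `Ω₂ × A_½(c) × (0, ∞)`. -/
theorem peircePoint_mem_cone (hτ : IsTraceForm 3 τ) (y : peirceZero c hc.idem) (w : peirceHalf c)
    (s : ℝ) : peircePoint τ y w s ∈ cone J 3 ↔ y ∈ cone (peirceZero c hc.idem) 2 ∧ 0 < s := by
  have hτ' := hτ.toIsEuclideanForm
  constructor
  · intro h
    have hy := mem_cone_two_of_mem_cone_three hτ hc hτ₀ y _ _ h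
    refine ⟨hy, ?_⟩
    have h1 := ((hτ.mem_cone_three _).mp h).2.2
    rw [jdet_peircePoint hc hcc hτ₀ hτ] at h1
    exact pos_of_mul_pos_left h1 ((hτ₀.mem_cone_two y).mp hy).2.le
  · rintro ⟨hy, hs⟩
    obtain ⟨ha, hD⟩ := (hτ₀.mem_cone_two y).mp hy
    -- `L(y)` is a combination, with positive coefficients, of multiplications by idempotents
    have hp : 0 ≤ τ (w : J) ((y : J) * w) := by
      obtain ⟨g, hg, hyg⟩ := eigenvalues_spec (hτ₀.exists_spectrum y)
      have : (y : J) = ∑ i, eigenvalues 2 y i • (g i : J) := by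
        rw [← coe_sum_smul_peirceZero, ← hyg]
      rw [this, Finset.sum_mul, map_sum]
      refine Finset.sum_nonneg fun i _ => ?_
      rw [smul_mul_assoc, map_smul, smul_eq_mul]
      exact mul_nonneg (hy i).le
        (hτ.idem_mul_nonneg (congrArg Subtype.val (hg.primitive i).idem) _)
    have hw := hτ.nonneg (w : J)
    refine (hτ.mem_cone_three _).mpr ⟨?_, ?_, ?_⟩
    · rw [one_peircePoint hτ' hc hcc]; positivity
    · have h2 := sq_peircePoint hτ' hc hcc hτ₀ y w s
      have : 0 < jdet 2 y + restrictForm τ c hc.idem y 1 * s + jdet 2 y * τ (w : J) w / 2 := by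
        positivity
      linarith
    · rw [jdet_peircePoint hc hcc hτ₀ hτ]; positivity

include hc hcc hτ₀ in
theorem jtrace_jinv_peircePoint (hτ : IsTraceForm 3 τ) {y : peirceZero c hc.idem}
    (w : peirceHalf c) {s : ℝ} (hy : y ∈ cone (peirceZero c hc.idem) 2) (hs : 0 < s) :
    jtrace 3 (jinv (peircePoint τ y w s)) =
      jtrace 2 (jinv y) + (1 / s + τ (w : J) w / 2 / s) := by
  have hD := ((hτ₀.mem_cone_two y).mp hy).2
  rw [hτ.jtrace_jinv_three ((peircePoint_mem_cone hc hcc hτ₀ hτ y w s).mpr ⟨hy, hs⟩),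
    sq_peircePoint hτ.toIsEuclideanForm hc hcc hτ₀, jdet_peircePoint hc hcc hτ₀ hτ,
    hτ₀.jtrace_jinv_two hy]
  field_simp
  ring

theorem form_peircePoint (hτ : IsEuclideanForm τ) (x y : peirceZero c hc.idem) (w : peirceHalf c)
    (s : ℝ) : τ (x : J) (peircePoint τ y w s) = restrictForm τ c hc.idem x y := by
  rw [peircePoint]
  simp only [map_add, map_smul, smul_eq_mul]
  rw [hτ.zero_half x.2 (peirceRep c hc.idem y w).2, hτ.zero_idem hc.idem x.2]
  change τ (x : J) y + _ = τ (x : J) y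
  ring

end PeirceCoordinates

/-! ### The determinant of the representation on `A_½(c)` -/

section Determinant

variable {J : Type*} [NonAssocCommRing J] [Module ℝ J] [SMulCommClass ℝ J J]
  [IsScalarTower ℝ J J] [FiniteDimensional ℝ J] [IsCommJordan J]

/-- `|det Φ(y)| = |det y| ^ d`. An off-diagonal element `u` of the frame of `y` interchanges the
two eigenvalues of `y`, so that `Φ(y)` and `Φ(y')`, where `y y' = det y`, are conjugate; and
`Φ(y) Φ(y') = det y`. -/
theorem abs_det_peirceRep [IsSimpleRing J] {τ : LinearMap.BilinForm ℝ J} (hτ : IsEuclideanForm τ)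
    {c : J} (hc : IsPrimitiveIdempotent c) (hτ₀ : IsTraceForm 2 (restrictForm τ c hc.idem))
    {d : ℕ} (hd : Module.finrank ℝ (peirceHalf c) = 2 * d) (y : peirceZero c hc.idem) :
    |LinearMap.det (peirceRep c hc.idem y)| = |jdet 2 y| ^ d := by
  obtain ⟨g, hg, hy⟩ := eigenvalues_spec (hτ₀.exists_spectrum y)
  have ht : IsTriple (g 0 : J) (g 1 : J) c := (IsJordanFrame.snoc hτ hc hg).isTriple
  obtain ⟨u, α, hu0, hu1, hα, hsq⟩ := ht.exists_offDiagonal hτ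
  have hcu : c * u = 0 := ht.mul_eq_zero hu0 hu1
  let u' : peirceZero c hc.idem := ⟨u, hcu⟩
  have h01 : g 0 + g 1 = 1 := by rw [← hg.complete, Fin.sum_univ_two]
  set Φ := peirceRep c hc.idem
  set U := Φ u'
  set P := Φ (g 0)
  set Q := Φ (g 1)
  set s := eigenvalues 2 y 0
  set t := eigenvalues 2 y 1
  have hPQ : P + Q = 1 := by rw [← map_add, h01]; exact peirceRep_one hc.idem
  have hPP : P * P = P := by
    rw [← peirceRep_mul_self, (hg.primitive 0).idem]
  have hQ : Q = 1 - P := by rw [← hPQ]; abel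
  have hUU : U * U = α • 1 := by
    rw [← peirceRep_mul_self, ← peirceRep_one hc.idem, ← map_smul]
    congr 1
    refine Subtype.ext ?_
    change u * u = α • (1 - c)
    rw [hsq, ← ht.sum, add_sub_cancel_right]
  have hUP : U * P + P * U = U := by
    rw [← two_smul_peirceRep_mul, ← map_smul]
    congr 1
    refine Subtype.ext ?_
    change (2 : ℝ) • (u * (g 0 : J)) = u
    rw [mul_comm, hu0]
    module
  have hΦy : Φ y = s • P + t • Q := by
    rw [hy, Fin.sum_univ_two, map_add, map_smul, map_smul]
  have hPU : P * U = U - U * P := eq_sub_of_add_eq' hUP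
  have hconj : U * (s • P + t • Q) = (t • P + s • Q) * U := by
    rw [hQ]
    simp only [mul_add, add_mul, mul_sub, sub_mul, mul_smul_comm, smul_mul_assoc, one_mul, mul_one,
      hPU]
    module
  have hprod : (s • P + t • Q) * (t • P + s • Q) = (s * t) • 1 := by
    rw [hQ]
    simp only [mul_add, add_mul, mul_sub, sub_mul, mul_smul_comm, smul_mul_assoc, one_mul, mul_one,
      hPP]
    module
  have hUdet : LinearMap.det U ≠ 0 := by
    intro h
    have := congrArg LinearMap.det hUU
    rw [map_mul, h, zero_mul, LinearMap.det_smul, map_one, mul_one] at this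
    exact pow_ne_zero _ hα.ne' this.symm
  have hdet : LinearMap.det (s • P + t • Q) = LinearMap.det (t • P + s • Q) := by
    have := congrArg LinearMap.det hconj
    rw [map_mul, map_mul, mul_comm] at this
    exact mul_right_cancel₀ hUdet this
  -- conjugate operators with product `s t`, on a space of dimension `2 d`
  have hsquare : LinearMap.det (s • P + t • Q) ^ 2 = ((s * t) ^ d) ^ 2 := by
    have := congrArg LinearMap.det hprod
    rw [map_mul, ← hdet, LinearMap.det_smul, map_one, mul_one, hd] at this
    rw [sq, this, ← pow_mul, mul_comm 2 d]
  rw [hΦy, jdet, Fin.prod_univ_two, ← abs_pow]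
  exact (sq_eq_sq_iff_abs_eq_abs _ _).mp hsquare

end Determinant

open MeasureTheory

/-! ### The Gamma integral -/

section GammaIntegral

/-- The integrand `s ^ (ν - 1) exp (-1 / s)`. -/
noncomputable def invGammaIntegrand (ν : ℂ) (s : ℝ) : ℂ :=
  (s : ℂ) ^ (ν - 1) * Complex.exp (-(1 / s : ℝ))

/-- The substitution `s ↦ s⁻¹` transforms the Gamma integrand with parameter `-ν` into
`invGammaIntegrand ν`. -/
theorem invGammaIntegrand_eq (ν : ℂ) {s : ℝ} (hs : 0 < s) :
    (|(-1 : ℝ)| * s ^ ((-1 : ℝ) - 1)) •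
      ((fun x : ℝ => ((Real.exp (-x) : ℝ) : ℂ) * (x : ℂ) ^ (-ν - 1)) (s ^ (-1 : ℝ))) =
      invGammaIntegrand ν s := by
  have hs' : (s : ℂ) ≠ 0 := by exact_mod_cast hs.ne'
  have harg : (s : ℂ).arg ≠ Real.pi := by
    rw [Complex.arg_ofReal_of_nonneg hs.le]; exact Real.pi_pos.ne
  dsimp only
  rw [invGammaIntegrand, Real.rpow_neg_one, abs_neg, abs_one, one_mul, Complex.real_smul,
    Complex.ofReal_inv, Complex.inv_cpow _ _ harg, Complex.ofReal_cpow hs.le,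
    ← Complex.cpow_neg, one_div, Complex.ofReal_exp]
  rw [show ∀ a b c : ℂ, a * (b * c) = a * c * b by intros; ring, ← Complex.cpow_add _ _ hs']
  congr 2
  · push_cast
    ring
  · push_cast
    rfl

theorem integrableOn_invGammaIntegrand_iff (ν : ℂ) :
    IntegrableOn (invGammaIntegrand ν) (Set.Ioi 0) ↔ ν.re < 0 := by
  have h1 : IntegrableOn (invGammaIntegrand ν) (Set.Ioi 0) ↔
      IntegrableOn (fun x : ℝ => ((Real.exp (-x) : ℝ) : ℂ) * (x : ℂ) ^ (-ν - 1)) (Set.Ioi 0) := by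
    rw [← integrableOn_Ioi_comp_rpow_iff
      (fun x : ℝ => ((Real.exp (-x) : ℝ) : ℂ) * (x : ℂ) ^ (-ν - 1)) (by norm_num : (-1 : ℝ) ≠ 0)]
    exact integrableOn_congr_fun (fun s hs => (invGammaIntegrand_eq ν hs).symm) measurableSet_Ioi
  rw [h1]
  constructor
  · intro h
    -- on `(0, 1)` the exponential is bounded below, so the power has to be integrable at `0`
    have h2 : IntegrableOn (fun x : ℝ => x ^ (-ν.re - 1)) (Set.Ioo 0 1) := by
      refine Integrable.mono' ((h.mono_set Set.Ioo_subset_Ioi_self).norm.const_mul (Real.exp 1))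
        ?_ ?_
      · exact (measurable_id.pow_const _).aestronglyMeasurable
      · refine (ae_restrict_iff' measurableSet_Ioo).mpr (ae_of_all _ fun x hx => ?_)
        rw [norm_mul, Complex.norm_cpow_eq_rpow_re_of_pos hx.1, Complex.norm_real,
          Real.norm_of_nonneg (Real.exp_pos _).le,
          Real.norm_of_nonneg (Real.rpow_nonneg hx.1.le _), ← mul_assoc, ← Real.exp_add]
        simp only [Complex.sub_re, Complex.neg_re, Complex.one_re]
        refine le_mul_of_one_le_left (Real.rpow_nonneg hx.1.le _) ?_
        exact Real.one_le_exp (by linarith [hx.2])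
    rw [intervalIntegral.integrableOn_Ioo_rpow_iff one_pos] at h2
    linarith
  · intro h
    exact Complex.GammaIntegral_convergent (s := -ν) (by simpa using h)

theorem integral_invGammaIntegrand {ν : ℂ} (hν : ν.re < 0) :
    ∫ s in Set.Ioi (0 : ℝ), invGammaIntegrand ν s = Complex.Gamma (-ν) := by
  rw [Complex.Gamma_eq_integral (by simpa using hν), Complex.GammaIntegral,
    ← integral_comp_rpow_Ioi
      (fun x : ℝ => ((Real.exp (-x) : ℝ) : ℂ) * (x : ℂ) ^ (-ν - 1)) (by norm_num : (-1 : ℝ) ≠ 0)]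
  exact setIntegral_congr_fun measurableSet_Ioi fun s hs => (invGammaIntegrand_eq ν hs).symm

end GammaIntegral

/-! ### The Gaussian integral over `A_½(c)` -/

section GaussianKernel

variable {ι : Type*} [Fintype ι]

/-- The integrand `s ^ (ν - 1 - d) exp (- 1 / s - |w|² / (2 s))` on `ℝ^{2d} × (0, ∞)`, extended by
zero. -/
noncomputable def gaussGammaKernel (ν : ℂ) (d : ℕ) (p : (ι → ℝ) × ℝ) : ℂ :=
  if 0 < p.2 then (p.2 : ℂ) ^ (ν - 1 - d) *
    Complex.exp (-((1 / p.2 + (∑ i, p.1 i ^ 2) / 2 / p.2 : ℝ) : ℂ)) else 0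

theorem measurable_gaussGammaKernel (ν : ℂ) (d : ℕ) :
    Measurable (gaussGammaKernel (ι := ι) ν d) := by
  unfold gaussGammaKernel
  refine Measurable.ite (measurableSet_lt measurable_const measurable_snd) ?_ measurable_const
  fun_prop

/-- The absolute value of the kernel is again a kernel, with real exponent. -/
theorem norm_gaussGammaKernel (ν : ℂ) (d : ℕ) (p : (ι → ℝ) × ℝ) :
    ((‖gaussGammaKernel ν d p‖ : ℝ) : ℂ) = gaussGammaKernel (ν.re : ℂ) d p := by
  unfold gaussGammaKernel
  split_ifs with h
  · rw [norm_mul, Complex.norm_cpow_eq_rpow_re_of_pos h, Complex.norm_exp, Complex.ofReal_mul,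
      Complex.ofReal_cpow h.le, Complex.ofReal_exp, Complex.neg_re, Complex.ofReal_re,
      Complex.ofReal_neg]
    simp only [Complex.sub_re, Complex.one_re, Complex.natCast_re, Complex.ofReal_sub,
      Complex.ofReal_one, Complex.ofReal_natCast]
  · simp

/-- For fixed `s` the kernel is a Gaussian in `w`; the vanishing linear term is the one of the
general Gaussian integral. -/
theorem gaussGammaKernel_slice (ν : ℂ) (d : ℕ) {s : ℝ} (hs : 0 < s) (w : ι → ℝ) :
    gaussGammaKernel ν d (w, s) = ((s : ℂ) ^ (ν - 1 - d) * Complex.exp (-(1 / s : ℝ))) *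
      Complex.exp (-((1 / (2 * s) : ℝ) : ℂ) * ∑ i, (w i : ℂ) ^ 2 +
        ∑ i, (0 : ι → ℂ) i * (w i : ℂ)) := by
  rw [gaussGammaKernel, if_pos hs, mul_assoc, ← Complex.exp_add]
  congr 2
  push_cast
  simp only [Pi.zero_apply, zero_mul, Finset.sum_const_zero]
  field_simp
  ring

theorem integrable_gaussGammaKernel_slice (ν : ℂ) (d : ℕ) (s : ℝ) :
    Integrable (fun w : ι → ℝ => gaussGammaKernel ν d (w, s)) := by
  by_cases hs : 0 < s
  · simp only [gaussGammaKernel_slice ν d hs]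
    exact (GaussianFourier.integrable_cexp_neg_mul_sum_add (by
      rw [Complex.ofReal_re]; positivity) _).const_mul _
  · simp [gaussGammaKernel, hs]

/-- The Gaussian integral over `w` contributes `(2 π s) ^ d`. -/
theorem integral_gaussGammaKernel_slice (ν : ℂ) {d : ℕ} (hd : Fintype.card ι = 2 * d) (s : ℝ) :
    ∫ w : ι → ℝ, gaussGammaKernel ν d (w, s) =
      (Set.Ioi 0).indicator (fun s => (2 * (Real.pi : ℂ)) ^ d * invGammaIntegrand ν s) s := by
  by_cases hs : 0 < s
  · rw [Set.indicator_of_mem (Set.mem_Ioi.mpr hs)]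
    simp only [gaussGammaKernel_slice ν d hs]
    have hs' : (s : ℂ) ≠ 0 := by exact_mod_cast hs.ne'
    rw [integral_const_mul, GaussianFourier.integral_cexp_neg_mul_sum_add (by
      rw [Complex.ofReal_re]; positivity), hd, invGammaIntegrand]
    have e1 : (((2 * d : ℕ) : ℂ) / 2) = (d : ℕ) := by push_cast; field_simp
    rw [e1, Complex.cpow_natCast]
    have e2 : (Real.pi : ℂ) / ((1 / (2 * s) : ℝ) : ℂ) = (2 * Real.pi) * s := by
      push_cast; field_simp
    rw [e2, mul_pow, Complex.cpow_sub _ _ hs', Complex.cpow_natCast]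
    simp only [Pi.zero_apply, ne_eq, OfNat.ofNat_ne_zero, not_false_eq_true, zero_pow,
      Finset.sum_const_zero, zero_div, Complex.exp_zero, mul_one]
    field_simp
  · rw [Set.indicator_of_notMem (by simpa using hs)]
    simp [gaussGammaKernel, hs]

theorem integrable_gaussGammaKernel_iff (ν : ℂ) {d : ℕ} (hd : Fintype.card ι = 2 * d) :
    Integrable (gaussGammaKernel (ι := ι) ν d) ↔ ν.re < 0 := by
  rw [Measure.volume_eq_prod,
    integrable_prod_iff' (measurable_gaussGammaKernel ν d).aestronglyMeasurable]
  -- the norm is itself a kernel with exponent `ν.re`, so the Gaussian integral applies to it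
  have h1 : (fun s : ℝ => ∫ w : ι → ℝ, ‖gaussGammaKernel ν d (w, s)‖) =
      (Set.Ioi 0).indicator (fun s => ‖(2 * (Real.pi : ℂ)) ^ d * invGammaIntegrand ν s‖) := by
    funext s
    have : ((∫ w : ι → ℝ, ‖gaussGammaKernel ν d (w, s)‖ : ℝ) : ℂ) =
        (Set.Ioi 0).indicator (fun s => (2 * (Real.pi : ℂ)) ^ d * invGammaIntegrand ν.re s) s := by
      rw [← integral_gaussGammaKernel_slice _ hd, ← integral_complex_ofReal]
      simp only [norm_gaussGammaKernel]
    by_cases hs : 0 < s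
    · rw [Set.indicator_of_mem (Set.mem_Ioi.mpr hs)] at this ⊢
      have h2 : ‖invGammaIntegrand ν s‖ = s ^ (ν.re - 1) * Real.exp (-(1 / s)) := by
        rw [invGammaIntegrand, norm_mul, Complex.norm_cpow_eq_rpow_re_of_pos hs, Complex.norm_exp]
        simp
      have h3 : invGammaIntegrand ν.re s = ((s ^ (ν.re - 1) * Real.exp (-(1 / s)) : ℝ) : ℂ) := by
        rw [invGammaIntegrand, Complex.ofReal_mul, Complex.ofReal_cpow hs.le, Complex.ofReal_exp]
        push_cast
        rfl
      rw [norm_mul, h2, norm_pow, norm_mul, Complex.norm_real, Real.norm_of_nonneg Real.pi_pos.le]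
      rw [h3] at this
      rw [Complex.norm_ofNat]
      exact_mod_cast this
    · rw [Set.indicator_of_notMem (by simpa using hs)] at this ⊢
      exact_mod_cast this
  have hc : (2 * (Real.pi : ℂ)) ^ d ≠ 0 := by
    have : (Real.pi : ℂ) ≠ 0 := by exact_mod_cast Real.pi_ne_zero
    exact pow_ne_zero _ (mul_ne_zero two_ne_zero this)
  rw [h1, integrable_indicator_iff measurableSet_Ioi, ← integrableOn_invGammaIntegrand_iff]
  have hmeas : Measurable (invGammaIntegrand ν) := by unfold invGammaIntegrand; fun_prop
  constructor
  · rintro ⟨-, h⟩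
    have h2 := (integrable_norm_iff (hmeas.const_mul _).aestronglyMeasurable).mp h
    exact (integrable_const_mul_iff (IsUnit.mk0 _ hc) _).mp h2
  · intro h
    exact ⟨ae_of_all _ fun s => integrable_gaussGammaKernel_slice ν d s,
      (Integrable.const_mul h _).norm⟩

theorem integral_gaussGammaKernel {ν : ℂ} (hν : ν.re < 0) {d : ℕ}
    (hd : Fintype.card ι = 2 * d) :
    ∫ p, gaussGammaKernel (ι := ι) ν d p = (2 * (Real.pi : ℂ)) ^ d * Complex.Gamma (-ν) := by
  have hint := (integrable_gaussGammaKernel_iff (ι := ι) ν hd).mpr hν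
  rw [Measure.volume_eq_prod] at hint ⊢
  rw [integral_prod_symm _ hint]
  simp only [integral_gaussGammaKernel_slice ν hd]
  rw [integral_indicator measurableSet_Ioi, integral_const_mul, integral_invGammaIntegrand hν]

theorem integral_norm_gaussGammaKernel_ne_zero {ν : ℂ} (hν : ν.re < 0) {d : ℕ}
    (hd : Fintype.card ι = 2 * d) : ∫ p, ‖gaussGammaKernel (ι := ι) ν d p‖ ≠ 0 := by
  intro h
  have h1 : ((∫ p, ‖gaussGammaKernel (ι := ι) ν d p‖ : ℝ) : ℂ) = 0 := by rw [h]; simp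
  rw [← integral_complex_ofReal] at h1
  simp only [norm_gaussGammaKernel] at h1
  rw [integral_gaussGammaKernel (by simpa using hν) hd] at h1
  have h2 : Complex.Gamma (-(ν.re : ℂ)) ≠ 0 :=
    Complex.Gamma_ne_zero_of_re_pos (by simpa using hν)
  have : (Real.pi : ℂ) ≠ 0 := by exact_mod_cast Real.pi_ne_zero
  exact mul_ne_zero (pow_ne_zero _ (mul_ne_zero two_ne_zero this)) h2 h1

end GaussianKernel

/-! ### Fubini and the shear change of variables -/

section Fubini

/-- If the slices of `G` are multiples `g u • κ` of a fixed function up to a change of variables,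
then `∫ G = (∫ g) (∫ κ)`, and `G` is integrable if and only if `g` and `κ` are. -/
theorem integrable_prod_iff_of_slices {W Z : Type*} [MeasurableSpace W] [MeasurableSpace Z]
    {μ : Measure W} {ρ : Measure Z} [SFinite μ] [SFinite ρ] {G : W × Z → ℂ} {g : W → ℂ} {κ : Z → ℂ}
    (hG : AEStronglyMeasurable G (μ.prod ρ)) (hg : AEStronglyMeasurable g μ)
    (hne : ¬ g =ᵐ[μ] 0)
    (h0 : ∀ u, g u = 0 → ∀ z, G (u, z) = 0)
    (hint : ∀ u, g u ≠ 0 → (Integrable (fun z => G (u, z)) ρ ↔ Integrable κ ρ))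
    (hval : ∀ u, g u ≠ 0 → ∫ z, G (u, z) ∂ρ = g u * ∫ z, κ z ∂ρ)
    (hnorm : ∀ u, g u ≠ 0 → ∫ z, ‖G (u, z)‖ ∂ρ = ‖g u‖ * ∫ z, ‖κ z‖ ∂ρ)
    (hκ : Integrable κ ρ → ∫ z, ‖κ z‖ ∂ρ ≠ 0) :
    (Integrable G (μ.prod ρ) ↔ Integrable κ ρ ∧ Integrable g μ) ∧
      (Integrable G (μ.prod ρ) → ∫ z, G z ∂(μ.prod ρ) = (∫ u, g u ∂μ) * ∫ z, κ z ∂ρ) := by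
  have hval' : ∀ u, ∫ z, G (u, z) ∂ρ = g u * ∫ z, κ z ∂ρ := by
    intro u
    by_cases h : g u = 0
    · simp [h0 u h, h]
    · exact hval u h
  have hnorm' : ∀ u, ∫ z, ‖G (u, z)‖ ∂ρ = ‖g u‖ * ∫ z, ‖κ z‖ ∂ρ := by
    intro u
    by_cases h : g u = 0
    · simp [h0 u h, h]
    · exact hnorm u h
  refine ⟨?_, fun h => ?_⟩
  · rw [integrable_prod_iff hG]
    simp only [hnorm']
    constructor
    · rintro ⟨h1, h2⟩
      -- `g` is not null, so some integrable slice of `G` is a nonzero multiple of `κ`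
      have hκi : Integrable κ ρ := by
        by_contra hcon
        refine hne (h1.mono fun u hu => ?_)
        by_contra hgu
        exact hcon ((hint u hgu).mp hu)
      refine ⟨hκi, ?_⟩
      rw [← integrable_norm_iff hg]
      exact (integrable_mul_const_iff (IsUnit.mk0 _ (hκ hκi)) _).mp h2
    · rintro ⟨h1, h2⟩
      refine ⟨ae_of_all _ fun u => ?_, h2.norm.mul_const _⟩
      by_cases h : g u = 0
      · simp [h0 u h]
      · exact (hint u h).mpr h1
  · rw [integral_prod _ h]
    simp only [hval']
    rw [integral_mul_const]

variable {ι : Type*} [Fintype ι]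

/-- The change of variables `(w, s) ↦ (T w, s + p w)`, of Jacobian `det T`. -/
theorem map_shear (T : (ι → ℝ) →ₗ[ℝ] (ι → ℝ)) (hT : LinearMap.det T ≠ 0) {p : (ι → ℝ) → ℝ}
    (hp : Measurable p) :
    ∃ Θ : ((ι → ℝ) × ℝ) ≃ᵐ ((ι → ℝ) × ℝ), (∀ w s, Θ (w, s) = (T w, s + p w)) ∧
      Measure.map Θ volume = ENNReal.ofReal |(LinearMap.det T)⁻¹| • volume := by
  classical
  let S : ((ι → ℝ) × ℝ) ≃ᵐ ((ι → ℝ) × ℝ) :=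
    { toFun := fun q => (q.1, q.2 + p q.1)
      invFun := fun q => (q.1, q.2 - p q.1)
      left_inv := fun q => by simp
      right_inv := fun q => by simp
      measurable_toFun := measurable_fst.prodMk (measurable_snd.add (hp.comp measurable_fst))
      measurable_invFun := measurable_fst.prodMk (measurable_snd.sub (hp.comp measurable_fst)) }
  have hS : MeasurePreserving S volume volume := by
    rw [Measure.volume_eq_prod]
    refine MeasurePreserving.skew_product (MeasurePreserving.id _)
      (g := fun w s => s + p w) (measurable_snd.add (hp.comp measurable_fst)) ?_
    exact ae_of_all _ fun w => (measurePreserving_add_right volume (p w)).map_eq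
  let e := (LinearEquiv.ofIsUnitDet (f := T) (v := Pi.basisFun ℝ ι) (v' := Pi.basisFun ℝ ι) (by
    rw [LinearMap.det_toMatrix]
    exact IsUnit.mk0 _ hT)).toContinuousLinearEquiv.toHomeomorph.toMeasurableEquiv
  have he : ∀ w, e w = T w := fun w => rfl
  refine ⟨S.trans (e.prodCongr (MeasurableEquiv.refl ℝ)), fun w s => ?_, ?_⟩
  · change (e w, s + p w) = _
    rw [he]
  · have h1 : Measure.map (e.prodCongr (MeasurableEquiv.refl ℝ)) (volume : Measure ((ι → ℝ) × ℝ)) =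
        ENNReal.ofReal |(LinearMap.det T)⁻¹| • volume := by
      have : ⇑(e.prodCongr (MeasurableEquiv.refl ℝ)) = Prod.map T id := by
        funext q; rfl
      rw [this, Measure.volume_eq_prod, ← Measure.map_prod_map _ _ (by fun_prop) measurable_id,
        Measure.map_linearMap_addHaar_eq_smul_addHaar _ hT, Measure.map_id, Measure.prod_smul_left]
    rw [MeasurableEquiv.coe_trans, ← Measure.map_map (MeasurableEquiv.measurable _) S.measurable,
      hS.map_eq, h1]

/-- A function which is a multiple `k κ` after the shear `(w, s) ↦ (T w, s + p w)` has the integral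
of `κ` times `|det T| k`. -/
theorem shear_change_of_variables (T : (ι → ℝ) →ₗ[ℝ] (ι → ℝ)) (hT : LinearMap.det T ≠ 0)
    {p : (ι → ℝ) → ℝ} (hp : Measurable p) {G κ : (ι → ℝ) × ℝ → ℂ} {k : ℂ} (hk : k ≠ 0)
    (h : ∀ w s, G (T w, s + p w) = k * κ (w, s)) :
    (Integrable G ↔ Integrable κ) ∧ ∫ z, G z = |LinearMap.det T| * k * ∫ z, κ z ∧
      ∫ z, ‖G z‖ = |LinearMap.det T| * ‖k‖ * ∫ z, ‖κ z‖ := by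
  obtain ⟨Θ, hΘ, hmap⟩ := map_shear T hT hp
  have hcomp : G ∘ Θ = fun z => k * κ z := by
    funext ⟨w, s⟩
    rw [Function.comp_apply, hΘ, h]
  have hvol : (volume : Measure ((ι → ℝ) × ℝ)) =
      ENNReal.ofReal |LinearMap.det T| • Measure.map Θ volume := by
    rw [hmap, smul_smul, ← ENNReal.ofReal_mul (abs_nonneg _), ← abs_mul, mul_inv_cancel₀ hT]
    simp
  have hpos : 0 < |LinearMap.det T| := abs_pos.mpr hT
  refine ⟨?_, ?_, ?_⟩
  · conv_lhs => rw [hvol]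
    rw [integrable_smul_measure (by simpa using hpos) ENNReal.ofReal_ne_top, integrable_map_equiv,
      hcomp]
    exact integrable_const_mul_iff (IsUnit.mk0 _ hk) _
  · conv_lhs => rw [hvol]
    rw [integral_smul_measure, integral_map_equiv, ENNReal.toReal_ofReal hpos.le]
    have : ∀ z, G (Θ z) = k * κ z := fun z => congrFun hcomp z
    simp only [this]
    rw [integral_const_mul, Complex.real_smul, mul_assoc]
  · conv_lhs => rw [hvol]
    rw [integral_smul_measure, integral_map_equiv, ENNReal.toReal_ofReal hpos.le]
    have : ∀ z, G (Θ z) = k * κ z := fun z => congrFun hcomp z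
    simp only [this, norm_mul]
    rw [integral_const_mul, smul_eq_mul, mul_assoc]

end Fubini

/-! ### Orthonormal coordinates -/

section OrthonormalCoordinates

/-- A linear isomorphism that preserves sums of squares preserves Lebesgue measure. -/
theorem measurePreserving_of_sum_sq {ι ι' : Type*} [Fintype ι] [Fintype ι']
    (e : (ι → ℝ) ≃ₗ[ℝ] (ι' → ℝ)) (he : ∀ u, ∑ i, e u i ^ 2 = ∑ i, u i ^ 2) :
    MeasurePreserving e volume volume := by
  let f : EuclideanSpace ℝ ι ≃ₗ[ℝ] EuclideanSpace ℝ ι' :=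
    (WithLp.linearEquiv 2 ℝ (ι → ℝ)).trans (e.trans (WithLp.linearEquiv 2 ℝ (ι' → ℝ)).symm)
  let F : EuclideanSpace ℝ ι ≃ₗᵢ[ℝ] EuclideanSpace ℝ ι' :=
    { f with
      norm_map' := fun u => by
        rw [EuclideanSpace.norm_eq, EuclideanSpace.norm_eq]
        congr 1
        simp only [Real.norm_eq_abs, sq_abs]
        exact he u.ofLp }
  exact (PiLp.volume_preserving_ofLp ι').comp
    (F.measurePreserving.comp (PiLp.volume_preserving_toLp ι))

/-- The form of `measurePreserving_of_sum_sq` for a product of three Euclidean spaces, the last of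
dimension one. -/
theorem measurePreserving_prod_of_sum_sq {ι₁ ι₂ ι' : Type*} [Fintype ι₁] [Fintype ι₂] [Fintype ι']
    (e : ((ι₁ → ℝ) × (ι₂ → ℝ) × ℝ) ≃ₗ[ℝ] (ι' → ℝ))
    (he : ∀ u v t, ∑ i, e (u, v, t) i ^ 2 = ∑ i, u i ^ 2 + (∑ i, v i ^ 2 + t ^ 2)) :
    MeasurePreserving e volume volume := by
  let σ : (ι₁ ⊕ (ι₂ ⊕ Unit) → ℝ) ≃ᵐ ((ι₁ → ℝ) × (ι₂ → ℝ) × ℝ) :=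
    (MeasurableEquiv.sumPiEquivProdPi fun _ => ℝ).trans
      ((MeasurableEquiv.refl _).prodCongr
        ((MeasurableEquiv.sumPiEquivProdPi fun _ => ℝ).trans
          ((MeasurableEquiv.refl _).prodCongr (MeasurableEquiv.funUnique Unit ℝ))))
  have hσ : MeasurePreserving σ volume volume :=
    ((MeasurePreserving.id volume).prod (((MeasurePreserving.id volume).prod
      (volume_preserving_funUnique Unit ℝ)).comp
        (volume_measurePreserving_sumPiEquivProdPi fun _ => ℝ))).comp
      (volume_measurePreserving_sumPiEquivProdPi fun _ => ℝ)
  let s : (ι₁ ⊕ (ι₂ ⊕ Unit) → ℝ) ≃ₗ[ℝ] ((ι₁ → ℝ) × (ι₂ → ℝ) × ℝ) :=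
    { σ.toEquiv with
      map_add' := fun _ _ => rfl
      map_smul' := fun _ _ => rfl }
  have h := measurePreserving_of_sum_sq (s.trans e) (fun u => by
    change ∑ i, e (σ u) i ^ 2 = _
    rw [show σ u = (fun i => u (.inl i), fun i => u (.inr (.inl i)), u (.inr (.inr ()))) from rfl,
      he]
    simp [Fintype.sum_sum_type])
  have h2 := h.comp hσ.symm
  have : (s.trans e) ∘ σ.symm = e := by
    funext z
    change e (σ (σ.symm z)) = e z
    rw [σ.apply_symm_apply]
  rwa [this] at h2

variable {J : Type*} [NonAssocCommRing J] [Module ℝ J] {τ : LinearMap.BilinForm ℝ J} {r : ℕ}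

/-- The coordinates `chart` are those of an orthonormal basis for the trace form. -/
theorem IsTraceForm.exists_chart [FiniteDimensional ℝ J] (hτ : IsTraceForm r τ) :
    ∃ b : Module.Basis (Fin (Module.finrank ℝ J)) ℝ J,
      (∀ i j, τ (b i) (b j) = if i = j then 1 else 0) ∧ ∀ u, chart J r u = b.equivFun.symm u := by
  classical
  have h : ∃ b : Module.Basis (Fin (Module.finrank ℝ J)) ℝ J, IsTraceOrthonormal r b := by
    obtain ⟨b, hb⟩ := exists_orthonormal_basis τ hτ.symm hτ.pos
    exact ⟨b, fun i j => by rw [hτ.jtrace_mul]; exact hb i j⟩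
  refine ⟨h.choose, fun i j => ?_, fun u => ?_⟩
  · rw [← hτ.jtrace_mul]; exact h.choose_spec i j
  · rw [chart, dif_pos h, Module.Basis.equivFun_symm_apply]

theorem form_equivFun_symm {V ι : Type*} [AddCommGroup V] [Module ℝ V] [Fintype ι] [DecidableEq ι]
    {τ : LinearMap.BilinForm ℝ V} {b : Module.Basis ι ℝ V}
    (hb : ∀ i j, τ (b i) (b j) = if i = j then 1 else 0) (u : ι → ℝ) :
    τ (b.equivFun.symm u) (b.equivFun.symm u) = ∑ i, u i ^ 2 := by
  simp [Module.Basis.equivFun_symm_apply, hb, sq]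

end OrthonormalCoordinates

/-! ### Continuity of polynomial functions in coordinates -/

section Continuity

variable {J ι : Type*} [AddCommGroup J] [Module ℝ J] [Fintype ι] (b : Module.Basis ι ℝ J)

theorem continuous_linear_coord (f : J →ₗ[ℝ] ℝ) : Continuous fun u => f (b.equivFun.symm u) :=
  (f ∘ₗ b.equivFun.symm.toLinearMap).continuous_of_finiteDimensional

theorem bilinear_coord (B : LinearMap.BilinForm ℝ J) (u : ι → ℝ) (z : J) :
    B (b.equivFun.symm u) z = ∑ i, u i * B (b i) z := by
  rw [Module.Basis.equivFun_symm_apply, map_sum, LinearMap.sum_apply]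
  simp

theorem continuous_bilinear_coord (B : LinearMap.BilinForm ℝ J) :
    Continuous fun u => B (b.equivFun.symm u) (b.equivFun.symm u) := by
  simp only [fun u => bilinear_coord b B u (b.equivFun.symm u)]
  exact continuous_finsetSum _ fun i _ =>
    (continuous_apply i).mul (continuous_linear_coord b (B (b i)))

end Continuity

/-! ### Extension of the integrand by zero -/

section Extension

variable {J : Type*} [NonAssocCommRing J] [Module ℝ J]

/-- The integrand of the K-Bessel function, extended by zero outside the cone. -/
noncomputable def besselExt (r : ℕ) (ν : ℂ) (x : J) : J → ℂ :=
  (cone J r).indicator (besselIntegrand r ν x)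

theorem besselExt_of_mem {r : ℕ} {ν : ℂ} {x y : J} (hy : y ∈ cone J r) :
    besselExt r ν x y = besselIntegrand r ν x y := Set.indicator_of_mem hy _

theorem besselExt_of_notMem {r : ℕ} {ν : ℂ} {x y : J} (hy : y ∉ cone J r) :
    besselExt r ν x y = 0 := Set.indicator_of_notMem hy _

variable {r : ℕ}

theorem besselConverges_iff {b : Module.Basis (Fin (Module.finrank ℝ J)) ℝ J}
    (hb : ∀ u, chart J r u = b.equivFun.symm u)
    (ho : IsOpen {u | b.equivFun.symm u ∈ cone J r}) (ν : ℂ) (x : J) :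
    BesselConverges r ν x ↔ Integrable fun u => besselExt r ν x (b.equivFun.symm u) := by
  rw [BesselConverges]
  simp only [hb]
  rw [← integrable_indicator_iff ho.measurableSet]
  rfl

theorem besselK_eq {b : Module.Basis (Fin (Module.finrank ℝ J)) ℝ J}
    (hb : ∀ u, chart J r u = b.equivFun.symm u)
    (ho : IsOpen {u | b.equivFun.symm u ∈ cone J r}) (ν : ℂ) (x : J) :
    besselK r ν x = ∫ u, besselExt r ν x (b.equivFun.symm u) := by
  rw [besselK]
  simp only [hb]
  rw [← integral_indicator ho.measurableSet]
  rfl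

end Extension

/-! ### Measurability of the integrand -/

section Measurability

variable {J ι : Type*} [NonAssocCommRing J] [Module ℝ J] [SMulCommClass ℝ J J]
  [IsScalarTower ℝ J J] [Fintype ι] (b : Module.Basis ι ℝ J) {τ : LinearMap.BilinForm ℝ J}

theorem continuous_cubic_coord (τ : LinearMap.BilinForm ℝ J) :
    Continuous fun u => τ (b.equivFun.symm u) (b.equivFun.symm u * b.equivFun.symm u) := by
  simp only [fun u => bilinear_coord b τ u (b.equivFun.symm u * b.equivFun.symm u)]
  exact continuous_finsetSum _ fun i _ => (continuous_apply i).mul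
    (continuous_bilinear_coord b ((LinearMap.mul ℝ J).compr₂ (τ (b i))))

theorem IsTraceForm.continuous_jdet_two (hτ : IsTraceForm 2 τ) :
    Continuous fun u => jdet 2 (b.equivFun.symm u) := by
  simp only [hτ.jdet_two]
  exact (((continuous_linear_coord b (τ.flip 1)).pow 2).sub
    (continuous_bilinear_coord b τ)).div_const _

theorem IsTraceForm.continuous_jdet_three (hτ : IsTraceForm 3 τ) :
    Continuous fun u => jdet 3 (b.equivFun.symm u) := by
  simp only [hτ.jdet_three]
  have h1 := continuous_linear_coord b (τ.flip 1)
  have h2 := continuous_bilinear_coord b τ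
  have h3 := continuous_cubic_coord b τ
  exact (((h1.pow 3).sub ((continuous_const.mul h1).mul h2)).add
    (continuous_const.mul h3)).div_const _

theorem IsTraceForm.isOpen_cone_two (hτ : IsTraceForm 2 τ) :
    IsOpen {u | b.equivFun.symm u ∈ cone J 2} := by
  simp only [hτ.mem_cone_two]
  exact (isOpen_lt continuous_const (continuous_linear_coord b (τ.flip 1))).inter
    (isOpen_lt continuous_const (hτ.continuous_jdet_two b))

theorem IsTraceForm.isOpen_cone_three (hτ : IsTraceForm 3 τ) :
    IsOpen {u | b.equivFun.symm u ∈ cone J 3} := by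
  simp only [hτ.mem_cone_three]
  have h1 := continuous_linear_coord b (τ.flip 1)
  exact (isOpen_lt continuous_const h1).inter ((isOpen_lt continuous_const
    ((h1.pow 2).sub (continuous_bilinear_coord b τ))).inter
    (isOpen_lt continuous_const (hτ.continuous_jdet_three b)))

/-- On the cone, `tr y⁻¹` and `det y` are rational functions of the coordinates of `y`. -/
theorem IsTraceForm.measurable_besselExt_two (hτ : IsTraceForm 2 τ) (ν : ℂ) (x : J) :
    Measurable fun u => besselExt 2 ν x (b.equivFun.symm u) := by
  have h1 := (continuous_linear_coord b (τ.flip 1)).measurable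
  have h2 := (hτ.continuous_jdet_two b).measurable
  have h3 := (continuous_linear_coord b (τ x)).measurable
  have h : (fun u => besselExt 2 ν x (b.equivFun.symm u)) =
      {u | b.equivFun.symm u ∈ cone J 2}.indicator (fun u =>
        Complex.exp (-((τ (b.equivFun.symm u) 1 / jdet 2 (b.equivFun.symm u) : ℝ) : ℂ) -
          (τ x (b.equivFun.symm u) : ℂ)) *
        (jdet 2 (b.equivFun.symm u) : ℂ) ^ (ν - (Module.finrank ℝ J : ℂ) / ((2 : ℕ) : ℂ))) := by
    funext u
    by_cases hu : b.equivFun.symm u ∈ cone J 2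
    · have hu' : u ∈ {u | b.equivFun.symm u ∈ cone J 2} := hu
      rw [besselExt_of_mem hu, Set.indicator_of_mem hu', besselIntegrand,
        hτ.jtrace_jinv_two hu, hτ.jtrace_mul]
    · have hu' : u ∉ {u | b.equivFun.symm u ∈ cone J 2} := hu
      rw [besselExt_of_notMem hu, Set.indicator_of_notMem hu']
  rw [h]
  refine Measurable.indicator ?_ (hτ.isOpen_cone_two b).measurableSet
  exact ((Complex.measurable_ofReal.comp (h1.div h2)).neg.sub
    (Complex.measurable_ofReal.comp h3)).cexp.mul ((Complex.measurable_ofReal.comp h2).pow_const _)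

/-- On the cone, `tr y⁻¹` and `det y` are rational functions of the coordinates of `y`. -/
theorem IsTraceForm.measurable_besselExt_three (hτ : IsTraceForm 3 τ) (ν : ℂ) (x : J) :
    Measurable fun u => besselExt 3 ν x (b.equivFun.symm u) := by
  have h1 := (continuous_linear_coord b (τ.flip 1)).measurable
  have h2 := (hτ.continuous_jdet_three b).measurable
  have h3 := (continuous_linear_coord b (τ x)).measurable
  have h4 := (continuous_bilinear_coord b τ).measurable
  have h : (fun u => besselExt 3 ν x (b.equivFun.symm u)) =
      {u | b.equivFun.symm u ∈ cone J 3}.indicator (fun u =>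
        Complex.exp (-(((τ (b.equivFun.symm u) 1 ^ 2 -
            τ (b.equivFun.symm u) (b.equivFun.symm u)) / 2 / jdet 3 (b.equivFun.symm u) : ℝ) : ℂ) -
          (τ x (b.equivFun.symm u) : ℂ)) *
        (jdet 3 (b.equivFun.symm u) : ℂ) ^ (ν - (Module.finrank ℝ J : ℂ) / ((3 : ℕ) : ℂ))) := by
    funext u
    by_cases hu : b.equivFun.symm u ∈ cone J 3
    · have hu' : u ∈ {u | b.equivFun.symm u ∈ cone J 3} := hu
      rw [besselExt_of_mem hu, Set.indicator_of_mem hu', besselIntegrand,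
        hτ.jtrace_jinv_three hu, hτ.jtrace_mul]
    · have hu' : u ∉ {u | b.equivFun.symm u ∈ cone J 3} := hu
      rw [besselExt_of_notMem hu, Set.indicator_of_notMem hu']
  rw [h]
  refine Measurable.indicator ?_ (hτ.isOpen_cone_three b).measurableSet
  exact ((Complex.measurable_ofReal.comp ((((h1.pow_const 2).sub h4).div_const 2).div h2)).neg.sub
    (Complex.measurable_ofReal.comp h3)).cexp.mul ((Complex.measurable_ofReal.comp h2).pow_const _)

end Measurability

/-! ### Convergence in rank two -/

section Convergence

/-- Comparison with `(1 + ‖u‖) ^ (-N)` for `N` larger than the dimension. -/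
theorem integrable_exp_neg_norm {ι : Type*} [Fintype ι] {m : ℝ} (hm : 0 < m) :
    Integrable fun u : ι → ℝ => Real.exp (-(m * ‖u‖)) := by
  set N := Fintype.card ι + 1
  have h := integrable_one_add_norm (E := ι → ℝ) (μ := volume) (r := N) (by
    rw [Module.finrank_pi]; simp [N])
  refine Integrable.mono' (h.const_mul (Real.exp m * N.factorial / m ^ N))
    (by fun_prop) (ae_of_all _ fun u => ?_)
  have hu : 0 < 1 + ‖u‖ := by positivity
  have h1 := Real.pow_div_factorial_le_exp (m * (1 + ‖u‖)) (by positivity) N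
  rw [Real.norm_of_nonneg (Real.exp_pos _).le, Real.rpow_neg hu.le, Real.rpow_natCast]
  have h2 : Real.exp (m * (1 + ‖u‖)) = Real.exp m / Real.exp (-(m * ‖u‖)) := by
    rw [← Real.exp_sub]; congr 1; ring
  rw [h2, div_le_div_iff₀ (by positivity) (Real.exp_pos _), mul_pow] at h1
  rw [← div_eq_mul_inv, div_div, le_div_iff₀ (by positivity)]
  linarith

/-- If `4 D ≤ a²` then `D ^ (-q) exp (-a / D)` is bounded. -/
theorem exists_rpow_mul_exp_le {q : ℝ} (hq : 0 ≤ q) : ∃ C : ℝ, ∀ a D : ℝ, 0 < a → 0 < D →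
    4 * D ≤ a ^ 2 → D ^ (-q) * Real.exp (-(a / D)) ≤ C := by
  obtain ⟨N, hN⟩ := exists_nat_ge (2 * q)
  refine ⟨1 + N.factorial, fun a D ha hD h => ?_⟩
  set z := a / D with hz
  have hz0 : 0 < z := by positivity
  have h1 : D⁻¹ ≤ z ^ 2 := by
    rw [hz, div_pow, inv_eq_one_div, div_le_div_iff₀ hD (by positivity)]
    nlinarith
  have h2 : D ^ (-q) ≤ z ^ (2 * q) := by
    rw [Real.rpow_neg hD.le, ← Real.inv_rpow hD.le, Real.rpow_mul hz0.le]
    exact Real.rpow_le_rpow (by positivity) (by exact_mod_cast h1) hq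
  have h3 : z ^ (2 * q) ≤ 1 + z ^ N := by
    rcases le_total z 1 with hz1 | hz1
    · have := Real.rpow_le_one hz0.le hz1 (by linarith : 0 ≤ 2 * q)
      have : 0 ≤ z ^ N := by positivity
      linarith
    · have := Real.rpow_le_rpow_of_exponent_le hz1 hN
      rw [Real.rpow_natCast] at this
      linarith
  have h4 := Real.pow_div_factorial_le_exp z hz0.le N
  rw [div_le_iff₀ (by positivity)] at h4
  have h5 : 1 ≤ Real.exp z := Real.one_le_exp hz0.le
  rw [Real.exp_neg, ← div_eq_mul_inv, div_le_iff₀ (Real.exp_pos _)]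
  linarith

variable {J : Type*} [NonAssocCommRing J] [Module ℝ J] [SMulCommClass ℝ J J]
  [IsScalarTower ℝ J J] [IsCommJordan J] {τ : LinearMap.BilinForm ℝ J}

/-- In rank two the integral converges at `x₁ c₁ + x₂ c₂` with `x₁, x₂ > 0` as soon as the exponent
of the determinant is nonpositive. -/
theorem integrable_besselExt_two (hτ : IsTraceForm 2 τ)
    {b : Module.Basis (Fin (Module.finrank ℝ J)) ℝ J}
    (hb : ∀ i j, τ (b i) (b j) = if i = j then 1 else 0) {ν : ℂ}
    (hν : ν.re ≤ (Module.finrank ℝ J : ℝ) / 2) {x a₁ a₂ : J} {x₁ x₂ : ℝ}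
    (hx₁ : 0 < x₁) (hx₂ : 0 < x₂)
    (h₁ : a₁ * a₁ = a₁) (h₂ : a₂ * a₂ = a₂) (h₁₂ : a₁ + a₂ = 1) (hx : x = x₁ • a₁ + x₂ • a₂) :
    Integrable fun u => besselExt 2 ν x (b.equivFun.symm u) := by
  set q := (Module.finrank ℝ J : ℝ) / 2 - ν.re with hq
  obtain ⟨C, hC⟩ := exists_rpow_mul_exp_le (q := q) (by linarith)
  set m := min x₁ x₂
  have hm : 0 < m := lt_min hx₁ hx₂
  refine Integrable.mono' ((integrable_exp_neg_norm hm).const_mul |C|)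
    (hτ.measurable_besselExt_two b ν x).aestronglyMeasurable (ae_of_all _ fun u => ?_)
  by_cases hu : b.equivFun.symm u ∈ cone J 2
  swap
  · rw [besselExt_of_notMem hu, norm_zero]; positivity
  rw [besselExt_of_mem hu, besselIntegrand, hτ.jtrace_jinv_two hu, hτ.jtrace_mul]
  obtain ⟨ha, hD⟩ := (hτ.mem_cone_two _).mp hu
  have hdet := hτ.jdet_two (b.equivFun.symm u)
  have hsq := form_equivFun_symm hb u
  set y := b.equivFun.symm u
  have h4 : 4 * jdet 2 y ≤ τ y 1 ^ 2 := by
    rw [jdet, ← hτ.sum_eigenvalues, Fin.sum_univ_two, Fin.prod_univ_two]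
    nlinarith [sq_nonneg (eigenvalues 2 y 0 - eigenvalues 2 y 1)]
  have hnonneg : ∀ a : J, a * a = a → 0 ≤ τ y a := by
    intro a h
    by_cases h0 : a = 0
    · simp [h0]
    · exact (hτ.idem_pos hu h h0).le
  have htr : m * τ y 1 ≤ τ x y := by
    rw [hx, ← h₁₂, map_add, map_add, LinearMap.add_apply, map_smul, map_smul,
      LinearMap.smul_apply, LinearMap.smul_apply, hτ.symm a₁, hτ.symm a₂, smul_eq_mul, smul_eq_mul,
      mul_add]
    exact add_le_add (mul_le_mul_of_nonneg_right (min_le_left _ _) (hnonneg a₁ h₁))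
      (mul_le_mul_of_nonneg_right (min_le_right _ _) (hnonneg a₂ h₂))
  -- `det y > 0` gives `(y, y) ≤ (tr y)²`; the sup norm of `u` is at most the Euclidean norm of `y`
  have hnorm : ‖u‖ ≤ τ y 1 := by
    refine (pi_norm_le_iff_of_nonneg ha.le).mpr fun i => ?_
    rw [Real.norm_eq_abs]
    refine abs_le_of_sq_le_sq ?_ ha.le
    have h5 : u i ^ 2 ≤ ∑ j, u j ^ 2 :=
      Finset.single_le_sum (f := fun j => u j ^ 2) (fun j _ => sq_nonneg _) (Finset.mem_univ i)
    linarith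
  rw [norm_mul, Complex.norm_exp, Complex.norm_cpow_eq_rpow_re_of_pos hD]
  have hre : (ν - (Module.finrank ℝ J : ℂ) / ((2 : ℕ) : ℂ)).re = -q := by
    rw [Complex.sub_re, hq]
    have : ((Module.finrank ℝ J : ℂ) / ((2 : ℕ) : ℂ)) =
        (((Module.finrank ℝ J : ℝ) / 2 : ℝ) : ℂ) := by
      push_cast; rfl
    rw [this, Complex.ofReal_re]
    ring
  rw [hre, Complex.sub_re, Complex.neg_re, Complex.ofReal_re, Complex.ofReal_re, sub_eq_add_neg,
    Real.exp_add]
  have hb1 := hC _ _ ha hD h4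
  have hb2 : Real.exp (-τ x y) ≤ Real.exp (-(m * ‖u‖)) := by
    refine Real.exp_le_exp.mpr (neg_le_neg (le_trans ?_ htr))
    exact mul_le_mul_of_nonneg_left hnorm hm.le
  calc Real.exp (-(τ y 1 / jdet 2 y)) * Real.exp (-τ x y) * jdet 2 y ^ (-q)
      = (jdet 2 y ^ (-q) * Real.exp (-(τ y 1 / jdet 2 y))) * Real.exp (-τ x y) := by ring
    _ ≤ |C| * Real.exp (-(m * ‖u‖)) := by
      refine mul_le_mul (hb1.trans (le_abs_self C)) hb2 (Real.exp_pos _).le (abs_nonneg _)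

end Convergence

/-! ### Reduction from rank three to rank two -/

section Reduction

variable {J : Type*} [NonAssocCommRing J] [Module ℝ J] [SMulCommClass ℝ J J]
  [IsScalarTower ℝ J J] [IsCommJordan J] {τ : LinearMap.BilinForm ℝ J} {c : J}

/-- In the coordinates of `peircePoint` the integrand is a product of a function of `y` and
the Gaussian-Gamma kernel. -/
theorem besselExt_peircePoint (hτ : IsTraceForm 3 τ) (hc : IsPrimitiveIdempotent c)
    (hcc : τ c c = 1) (hτ₀ : IsTraceForm 2 (restrictForm τ c hc.idem)) {d : ℕ}
    (hd : Module.finrank ℝ J = 3 + 3 * d) {ι : Type*} [Fintype ι] [DecidableEq ι]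
    {b : Module.Basis ι ℝ (peirceHalf c)}
    (hb : ∀ i j, τ (b i : J) (b j) = if i = j then 1 else 0) (ν : ℂ)
    (x : peirceZero c hc.idem) {y : peirceZero c hc.idem}
    (hy : y ∈ cone (peirceZero c hc.idem) 2) (w : ι → ℝ) (s : ℝ) :
    besselExt 3 ν (x : J) (peircePoint τ y (b.equivFun.symm w) s) =
      (Complex.exp (-(jtrace 2 (jinv y) : ℂ) - (jtrace 2 (x * y) : ℂ)) *
        (jdet 2 y : ℂ) ^ (ν - 1 - d)) * gaussGammaKernel ν d (w, s) := by
  have hD := ((hτ₀.mem_cone_two y).mp hy).2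
  by_cases hs : 0 < s
  · have hmem := (peircePoint_mem_cone hc hcc hτ₀ hτ y (b.equivFun.symm w) s).mpr ⟨hy, hs⟩
    have hw : τ (b.equivFun.symm w : J) (b.equivFun.symm w) = ∑ i, w i ^ 2 :=
      form_equivFun_symm
        (τ := τ.compl₁₂ (peirceHalf c).subtype (peirceHalf c).subtype) (b := b) hb w
    have hexp : ν - ((3 + 3 * d : ℕ) : ℂ) / ((3 : ℕ) : ℂ) = ν - 1 - d := by
      push_cast
      ring
    -- the inner product with `x` only sees the `A_0(c)`-component `y`
    rw [besselExt_of_mem hmem, besselIntegrand, jtrace_jinv_peircePoint hc hcc hτ₀ hτ _ hy hs,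
      hτ.jtrace_mul, form_peircePoint hc hτ.toIsEuclideanForm, jdet_peircePoint hc hcc hτ₀ hτ,
      hτ₀.jtrace_mul, hw, hd, hexp, gaussGammaKernel, if_pos hs, Complex.ofReal_mul,
      Complex.mul_cpow_ofReal_nonneg hs.le hD.le]
    have hE : Complex.exp (-((jtrace 2 (jinv y) + (1 / s + (∑ i, w i ^ 2) / 2 / s) : ℝ) : ℂ) -
        ((restrictForm τ c hc.idem x y : ℝ) : ℂ)) =
        Complex.exp (-(jtrace 2 (jinv y) : ℂ) - ((restrictForm τ c hc.idem x y : ℝ) : ℂ)) *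
          Complex.exp (-((1 / s + (∑ i, w i ^ 2) / 2 / s : ℝ) : ℂ)) := by
      rw [← Complex.exp_add]
      congr 1
      push_cast
      ring
    rw [hE]
    ring
  · have hmem : peircePoint τ y (b.equivFun.symm w) s ∉ cone J 3 := fun h =>
      hs ((peircePoint_mem_cone hc hcc hτ₀ hτ y (b.equivFun.symm w) s).mp h).2
    rw [besselExt_of_notMem hmem, gaussGammaKernel, if_neg hs, mul_zero]

/-- Integration over `A_½(c) ⊕ ℝ c` for fixed `y ∈ Ω₂`. In the coordinates `(w, s)` of `peircePoint`
the integrand is a multiple of `gaussGammaKernel ν d`, and the Jacobian `|det Φ(y)| = (det y) ^ d`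
raises the exponent `ν - 1 - d` of `det y` to that of the rank two integrand with parameter
`ν + d / 2`. -/
theorem slice_integral [FiniteDimensional ℝ J] [IsSimpleRing J] (hτ : IsTraceForm 3 τ)
    (hc : IsPrimitiveIdempotent c)
    (hcc : τ c c = 1) (hτ₀ : IsTraceForm 2 (restrictForm τ c hc.idem)) {d : ℕ}
    (hd : Module.finrank ℝ J = 3 + 3 * d) (hhalf : Module.finrank ℝ (peirceHalf c) = 2 * d)
    {ι : Type*} [Fintype ι] [DecidableEq ι]
    {b : Module.Basis ι ℝ (peirceHalf c)}
    (hb : ∀ i j, τ (b i : J) (b j) = if i = j then 1 else 0) (ν : ℂ)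
    (x : peirceZero c hc.idem) {y : peirceZero c hc.idem}
    (hy : y ∈ cone (peirceZero c hc.idem) 2) {G : (ι → ℝ) × ℝ → ℂ}
    (hG : ∀ v t, G (v, t) = besselExt 3 ν (x : J)
      (peirceEquiv hτ.toIsEuclideanForm hc (y, b.equivFun.symm v, t))) :
    besselExt 2 (ν + (d : ℂ) / 2) x y ≠ 0 ∧
    (Integrable G ↔ Integrable (gaussGammaKernel (ι := ι) ν d)) ∧
      ∫ z, G z = besselExt 2 (ν + (d : ℂ) / 2) x y * ∫ z, gaussGammaKernel (ι := ι) ν d z ∧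
      ∫ z, ‖G z‖ =
        ‖besselExt 2 (ν + (d : ℂ) / 2) x y‖ * ∫ z, ‖gaussGammaKernel (ι := ι) ν d z‖ := by
  have hD := ((hτ₀.mem_cone_two y).mp hy).2
  have hDC : (jdet 2 y : ℂ) ≠ 0 := by exact_mod_cast hD.ne'
  set k : ℂ := Complex.exp (-(jtrace 2 (jinv y) : ℂ) - (jtrace 2 (x * y) : ℂ)) *
        (jdet 2 y : ℂ) ^ (ν - 1 - d) with hk
  have hk0 : k ≠ 0 := by
    refine mul_ne_zero (Complex.exp_ne_zero _) ?_
    rw [Complex.cpow_def_of_ne_zero hDC]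
    exact Complex.exp_ne_zero _
  let Φ := peirceRep c hc.idem y
  let T : (ι → ℝ) →ₗ[ℝ] (ι → ℝ) := b.equivFun.toLinearMap ∘ₗ Φ ∘ₗ b.equivFun.symm.toLinearMap
  have hdetT : |LinearMap.det T| = jdet 2 y ^ d := by
    have h1 : LinearMap.det T = LinearMap.det Φ := LinearMap.det_conj Φ b.equivFun
    rw [h1, abs_det_peirceRep hτ.toIsEuclideanForm hc hτ₀ hhalf, abs_of_pos hD]
  have hT0 : LinearMap.det T ≠ 0 := by
    rw [← abs_pos, hdetT]; positivity
  let B : LinearMap.BilinForm ℝ (peirceHalf c) :=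
    τ.compl₁₂ (peirceHalf c).subtype ((LinearMap.mulLeft ℝ (y : J)) ∘ₗ (peirceHalf c).subtype)
  -- the shift of the `c`-coordinate is the quadratic form `½ (w, Φ(y) w) = (w, y w)`
  have hshear := shear_change_of_variables T hT0
    (p := fun w => B (b.equivFun.symm w) (b.equivFun.symm w))
    (continuous_bilinear_coord b B).measurable (G := G) (κ := gaussGammaKernel ν d) hk0 (by
      intro w s
      rw [hG, hk, ← besselExt_peircePoint hτ hc hcc hτ₀ hd hb ν x hy w s, peirceEquiv_apply,
        peircePoint]
      congr 4
      exact b.equivFun.symm_apply_apply _)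
  have hn : Module.finrank ℝ (peirceZero c hc.idem) = 2 + d := by
    have := finrank_peirce hτ.toIsEuclideanForm hc
    omega
  have hval : ((|LinearMap.det T| : ℝ) : ℂ) * k = besselExt 2 (ν + (d : ℂ) / 2) x y := by
    have hexp : ν + (d : ℂ) / 2 - ((2 + d : ℕ) : ℂ) / ((2 : ℕ) : ℂ) = d + (ν - 1 - d) := by
      push_cast
      ring
    rw [besselExt_of_mem hy, besselIntegrand, hn, hexp, Complex.cpow_add _ _ hDC,
      Complex.cpow_natCast, hdetT, hk]
    push_cast
    ring
  have hval' : |LinearMap.det T| * ‖k‖ = ‖besselExt 2 (ν + (d : ℂ) / 2) x y‖ := by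
    rw [← hval, norm_mul ((|LinearMap.det T| : ℝ) : ℂ) k, Complex.norm_real,
      Real.norm_of_nonneg (abs_nonneg _)]
  refine ⟨?_, hshear.1, ?_, ?_⟩
  · rw [← hval]
    exact mul_ne_zero (by exact_mod_cast abs_ne_zero.mpr hT0) hk0
  · rw [← hval]; exact hshear.2.1
  · rw [← hval']; exact hshear.2.2

theorem one_mem_cone_two {J : Type*} [NonAssocCommRing J] [Module ℝ J] [SMulCommClass ℝ J J]
    [IsScalarTower ℝ J J] {τ : LinearMap.BilinForm ℝ J} (hτ : IsTraceForm 2 τ) :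
    (1 : J) ∈ cone J 2 := by
  obtain ⟨lam, f, hf, -⟩ := hτ.exists_spectrum 1
  have h1 : τ (1 : J) 1 = 2 := by
    have := hτ.apply_one_sum hf 1
    simp only [Pi.one_apply, one_smul, hf.complete] at this
    simpa using this
  rw [hτ.mem_cone_two, hτ.jdet_two, h1]
  norm_num

/-- The rank three integral at a point `x` of `A_0(c)` is the product of the rank two integral at
`x` and the integral of `gaussGammaKernel`, with absolute convergence on either side equivalent. -/
theorem bessel_reduction [FiniteDimensional ℝ J] [IsSimpleRing J] (hτ : IsTraceForm 3 τ)
    (hc : IsPrimitiveIdempotent c)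
    (hcc : τ c c = 1) (hτ₀ : IsTraceForm 2 (restrictForm τ c hc.idem)) {d : ℕ}
    (hd : Module.finrank ℝ J = 3 + 3 * d) (hhalf : Module.finrank ℝ (peirceHalf c) = 2 * d)
    (ν : ℂ) (x : peirceZero c hc.idem) :
    (BesselConverges 3 ν (x : J) ↔ ν.re < 0 ∧ BesselConverges 2 (ν + (d : ℂ) / 2) x) ∧
    (BesselConverges 3 ν (x : J) → besselK 3 ν (x : J) =
      (2 * (Real.pi : ℂ)) ^ d * Complex.Gamma (-ν) * besselK 2 (ν + (d : ℂ) / 2) x) := by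
  obtain ⟨b, hb, hchart⟩ := hτ.exists_chart
  obtain ⟨b₀, hb₀, hchart₀⟩ := hτ₀.exists_chart
  obtain ⟨bh, hbh⟩ := exists_orthonormal_basis
    (τ.compl₁₂ (peirceHalf c).subtype (peirceHalf c).subtype) (fun v w => hτ.symm _ _)
    (fun v hv => hτ.pos _ (fun h => hv (Subtype.ext h)))
  have ho := hτ.isOpen_cone_three b
  have ho₀ := hτ₀.isOpen_cone_two b₀
  rw [besselConverges_iff hchart ho, besselConverges_iff hchart₀ ho₀, besselK_eq hchart ho,
    besselK_eq hchart₀ ho₀]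
  have hτ' := hτ.toIsEuclideanForm
  let e := (b₀.equivFun.symm.prodCongr (bh.equivFun.symm.prodCongr (LinearEquiv.refl ℝ ℝ))).trans
    ((peirceEquiv hτ' hc).trans b.equivFun)
  have he : ∀ u v t, b.equivFun.symm (e (u, v, t)) =
      peirceEquiv hτ' hc (b₀.equivFun.symm u, bh.equivFun.symm v, t) := fun u v t =>
    b.equivFun.symm_apply_apply _
  -- the Peirce decomposition is orthogonal, hence an isometry in orthonormal coordinates
  have hmp : MeasurePreserving e volume volume := by
    refine measurePreserving_prod_of_sum_sq e fun u v t => ?_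
    rw [← form_equivFun_symm hb, he, peirceEquiv_apply,
      hτ'.peirce_sq hc.idem hcc (b₀.equivFun.symm u).2 (bh.equivFun.symm v).2,
      ← form_equivFun_symm hb₀, ← form_equivFun_symm hbh, add_assoc]
    rfl
  have hemb : MeasurableEmbedding e :=
    e.toContinuousLinearEquiv.toHomeomorph.measurableEmbedding
  set F : (Fin (Module.finrank ℝ J) → ℝ) → ℂ :=
    fun u => besselExt 3 ν (x : J) (b.equivFun.symm u) with hF
  set g : (Fin (Module.finrank ℝ (peirceZero c hc.idem)) → ℝ) → ℂ :=
    fun u => besselExt 2 (ν + (d : ℂ) / 2) x (b₀.equivFun.symm u) with hg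
  have hcard : Fintype.card (Fin (Module.finrank ℝ (peirceHalf c))) = 2 * d := by
    rw [Fintype.card_fin, hhalf]
  have hzero : ∀ u, g u = 0 → b₀.equivFun.symm u ∉ cone (peirceZero c hc.idem) 2 := by
    intro u hu hmem
    exact (slice_integral hτ hc hcc hτ₀ hd hhalf hbh ν x hmem
      (G := fun z => besselExt 3 ν (x : J)
        (peirceEquiv hτ' hc (b₀.equivFun.symm u, bh.equivFun.symm z.1, z.2)))
      (fun _ _ => rfl)).1 hu
  have hmem : ∀ u, g u ≠ 0 → b₀.equivFun.symm u ∈ cone (peirceZero c hc.idem) 2 := by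
    intro u hu
    by_contra h
    exact hu (besselExt_of_notMem h)
  have hslice : ∀ u v t, (F ∘ e) (u, v, t) = besselExt 3 ν (x : J)
      (peirceEquiv hτ' hc (b₀.equivFun.symm u, bh.equivFun.symm v, t)) := by
    intro u v t
    change besselExt 3 ν (x : J) (b.equivFun.symm (e (u, v, t))) = _
    rw [he]
  -- `g` has no zeros on the cone, which is open and nonempty
  have hne : ¬ g =ᵐ[volume] 0 := by
    intro h
    have hsub : {u | b₀.equivFun.symm u ∈ cone (peirceZero c hc.idem) 2} ⊆ {u | ¬ g u = 0} :=
      fun u hu h0 => hzero u h0 hu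
    have hnull := measure_mono_null hsub (ae_iff.mp h)
    refine (ho₀.measure_pos volume ⟨b₀.equivFun 1, ?_⟩).ne' hnull
    change b₀.equivFun.symm (b₀.equivFun 1) ∈ cone (peirceZero c hc.idem) 2
    rw [LinearEquiv.symm_apply_apply]
    exact one_mem_cone_two hτ₀
  have key := integrable_prod_iff_of_slices (μ := volume) (ρ := volume)
    (G := F ∘ e) (g := g)
    (κ := gaussGammaKernel (ι := Fin (Module.finrank ℝ (peirceHalf c))) ν d)
    ((hτ.measurable_besselExt_three b ν x).comp hemb.measurable).aestronglyMeasurable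
    (hτ₀.measurable_besselExt_two b₀ _ x).aestronglyMeasurable hne
    (fun u hu z => by
      obtain ⟨v, t⟩ := z
      rw [hslice]
      exact besselExt_of_notMem fun h =>
        hzero u hu (mem_cone_two_of_mem_cone_three hτ hc hτ₀ _ _ _ h))
    (fun u hu => (slice_integral hτ hc hcc hτ₀ hd hhalf hbh ν x (hmem u hu) (hslice u)).2.1)
    (fun u hu => (slice_integral hτ hc hcc hτ₀ hd hhalf hbh ν x (hmem u hu) (hslice u)).2.2.1)
    (fun u hu => (slice_integral hτ hc hcc hτ₀ hd hhalf hbh ν x (hmem u hu) (hslice u)).2.2.2)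
    (fun h => integral_norm_gaussGammaKernel_ne_zero
      ((integrable_gaussGammaKernel_iff ν hcard).mp h) hcard)
  rw [← Measure.volume_eq_prod, hmp.integrable_comp_emb hemb,
    integrable_gaussGammaKernel_iff ν hcard] at key
  refine ⟨key.1, fun h => ?_⟩
  have h2 := key.2 h
  rw [integral_gaussGammaKernel (key.1.mp h).1 hcard] at h2
  rw [← hmp.integral_comp hemb, mul_comm]
  exact h2

end Reduction

end JordanBessel

theorem mainTheorem2 {A : Type*} [NonAssocCommRing A] [Module ℝ A] [IsScalarTower ℝ A A]
    [SMulCommClass ℝ A A] [FiniteDimensional ℝ A] [IsCommJordan A] [IsSimpleRing A]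
    (hA : JordanBessel.IsEuclidean A) (hrank : JordanBessel.jrank A = 3)
    (d : ℕ) (hd : Module.finrank ℝ A = 3 + 3 * d)
    (c : Fin 3 → A) (hc : JordanBessel.IsJordanFrame c)
    (ν : ℂ) (x₁ x₂ : ℝ) (hx₁ : 0 ≤ x₁) (hx₂ : 0 ≤ x₂) :
    (ν.re < 0 → 0 < x₁ → 0 < x₂ →
      JordanBessel.BesselConverges 3 ν (x₁ • c 0 + x₂ • c 1)) ∧
    (JordanBessel.BesselConverges 3 ν (x₁ • c 0 + x₂ • c 1) ↔
      ν.re < 0 ∧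
        JordanBessel.BesselConverges 2 (ν + (d : ℂ) / 2) (JordanBessel.facePoint c hc x₁ x₂)) ∧
    (JordanBessel.BesselConverges 3 ν (x₁ • c 0 + x₂ • c 1) →
      JordanBessel.besselK 3 ν (x₁ • c 0 + x₂ • c 1) =
        (2 * (Real.pi : ℂ)) ^ d * Complex.Gamma (-ν) *
          JordanBessel.besselK 2 (ν + (d : ℂ) / 2) (JordanBessel.facePoint c hc x₁ x₂)) := by
  open JordanBessel in
  obtain ⟨τ, hτ⟩ := exists_isTraceForm_three hA hrank hc
  have hτ₀ := hτ.peirceZero hrank hc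
  have hc2 := hc.primitive 2
  have hcc : τ (c 2) (c 2) = 1 := by
    rw [← hτ.mul_one_right, hc2.idem, hτ.apply_one c hc]
  have hhalf : Module.finrank ℝ (peirceHalf (c 2)) = 2 * d :=
    hc.isTriple.swap₂₃.swap₁₂.finrank_peirceHalf hτ.toIsEuclideanForm hd
  have key := bessel_reduction hτ hc2 hcc hτ₀ hd hhalf ν (facePoint c hc x₁ x₂)
  refine ⟨fun hν h₁ h₂ => ?_, key⟩
  refine key.1.mpr ⟨hν, ?_⟩
  obtain ⟨b₀, hb₀, hchart₀⟩ := hτ₀.exists_chart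
  rw [besselConverges_iff hchart₀ (hτ₀.isOpen_cone_two b₀)]
  have hn : Module.finrank ℝ (frameZero c hc) = 2 + d := by
    have := finrank_peirce hτ.toIsEuclideanForm hc2
    change _ = Module.finrank ℝ (frameZero c hc) + _ at this
    omega
  -- the exponent of the determinant, `ν + d / 2 - (2 + d) / 2 = ν - 1`, has negative real part
  refine integrable_besselExt_two hτ₀ hb₀ ?_ h₁ h₂
    (a₁ := ⟨c 0, hc.orthogonal 2 0 (by decide)⟩) (a₂ := ⟨c 1, hc.orthogonal 2 1 (by decide)⟩)
    (Subtype.ext (hc.primitive 0).idem) (Subtype.ext (hc.primitive 1).idem)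
    (Subtype.ext ?_) rfl
  · have : (ν + (d : ℂ) / 2).re = ν.re + d / 2 := by
      rw [Complex.add_re, show (d : ℂ) / 2 = ((d / 2 : ℝ) : ℂ) by push_cast; rfl, Complex.ofReal_re]
    change _ ≤ (Module.finrank ℝ (frameZero c hc) : ℝ) / 2
    rw [this, hn]
    push_cast
    linarith
  · change c 0 + c 1 = 1 - c 2
    rw [← hc.complete, Fin.sum_univ_three]
    abel
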